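/- Let $v_1,\dots,v_n\in\mathbb{R}^\ell$ be nonzero vectors whose orthogonal hyperplanes $H_i=\{x : v_i\cdot x=0\}$ are pairwise distinct, let $\mathcal{A}=\{H_1,\dots,H_n\}$, and put $H_i^+=\{x: v_i\cdot x>0\}$. Let $W\subseteq[n]$ and let $\mathcal{K}=\bigcap_{i\in W}H_i^+$ be the corresponding cone (any central arrangement and any cone of it are of this form after choosing the normal vectors suitably). Let $\mathcal{C}(\mathcal{K})$ be the set of chambers of $\mathcal{A}$ (connected components of $\mathbb{R}^\ell\setminus\bigcup_i H_i$) contained in $\mathcal{K}$, and let $VG(\mathcal{K})$ be the ring of all maps $\mathcal{C}(\mathcal{K})\to\mathbb{Z}$ with pointwise operations. Let $x_i\in VG(\mathcal{K})$ be the Heaviside function, equal to $1$ on the chambers contained in $H_i^+$ and to $0$ on the others. Let $F_d\subseteq VG(\mathcal{K})$ be the $\mathbb{Z}$-span of the products of at most $d$ Heaviside functions (repetitions allowed), $F_{-1}=0$, and let $\mathcal{V}(\mathcal{K})=\bigoplus_{d\ge0}F_d/F_{d-1}$ be the associated graded ring, with Hilbert series $\mathrm{Hilb}(\mathcal{V}(\mathcal{K}),t)=\sum_d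 \mathrm{rank}_{\mathbb{Z}}(F_d/F_{d-1})\,t^d$. A signed circuit is a pair $C=(C^+,C^-)$ of disjoint subsets of $[n]$ for which there is a relation $\sum_i\lambda_iv_i=0$ with $C^+=\{i:\lambda_i>0\}$ and $C^-=\{i:\lambda_i<0\}$, whose support $\underline{C}=C^+\cup C^-$ is nonempty and minimal under inclusion among the nonempty supports of such pairs. Write $e_S=\prod_{i\in S}e_i$ for $S\subseteq[n]$. Let $\mathcal{G}\subset\mathbb{Z}[e_1,\dots,e_n]$ be the set of the following polynomials: - (Idempotent) $e_i^2-e_i$ for $i\in[n]$; - (Unit) $e_i-1$ for $i\in W$; - (Cone-Circuit) $e_{C^+\setminus W}\prod_{j\in C^-}(e_j-1)$ for all signed circuits $C$ with $\emptyset\ne W\cap C^+=W\cap\underline{C}$, and $e_{C^-\setminus W}\prod_{j\in C^+}(e_j-1)$ for all signed circuits $C$ with $\emptyset\ne W\cap C^-=W\cap\underline{C}$; - (Circuit) $e_{C^+}\prod_{j\in C^-}(e_j-1)-e_{C^-}\prod_{j\in C^+}(e_j-1)$ for all signed circuits $C$ with $W\cap\underline{C}=\emptyset$. Let $\mathrm{in}_{\deg}(\mathcal{G})$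 be the set of the top-degree homogeneous parts $\mathrm{in}_{\deg}(g)$ of the $g\in\mathcal{G}$. Let $\prec$ be a monomial order on $\mathbb{Z}[e_1,\dots,e_n]$ which refines the ordering by total degree. A broken circuit is a set $\underline{C}\setminus\{i_0\}$, where $C$ is a signed circuit and $i_0$ is the $\prec$-smallest element of $\underline{C}$, that is, $e_{i_0}\preceq e_j$ for all $j\in\underline{C}$ (the smallest index, if $e_1\prec\dots\prec e_n$). Let $NBC(\mathcal{K})$ be the set of all $N\subseteq[n]$ which contain no broken circuit and satisfy $\mathcal{K}\cap\bigcap_{i\in N}H_i\neq\emptyset$. Let $\mathcal{L}^{\mathrm{int}}(\mathcal{K})$ be the set of those intersections $X$ of hyperplanes of $\mathcal{A}$ (including the empty intersection $V=\mathbb{R}^\ell$) with $X\cap\mathcal{K}\neq\emptyset$, ordered by reverse inclusion, with Möbius function $\mu$, and let $\mathrm{Poin}(\mathcal{K},t)=\sum_{X\in\mathcal{L}^{\mathrm{int}}(\mathcal{K})}|\mu(V,X)|\,t^{\mathrm{codim}X}$. Then there are ring isomorphisms $$\mathbb{Z}[e_1,\dots,e_n]/(\mathcal{G})\;\cong\;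 VG(\mathcal{K}),\ e_i\mapsto x_i,\qquad \mathbb{Z}[e_1,\dots,e_n]/(\mathrm{in}_{\deg}(\mathcal{G}))\;\cong\;\mathcal{V}(\mathcal{K}),\ e_i\mapsto \bar x_i\in F_1/F_0,$$ the images of the monomials $e_N$, $N\in NBC(\mathcal{K})$, form a $\mathbb{Z}$-basis of $VG(\mathcal{K})$ and a $\mathbb{Z}$-basis of $\mathcal{V}(\mathcal{K})$, and $$\mathrm{Hilb}(\mathcal{V}(\mathcal{K}),t)=\sum_{N\in NBC(\mathcal{K})}t^{\#N}=\mathrm{Poin}(\mathcal{K},t).$$ -/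

import Mathlib

open scoped DirectSum

noncomputable section

/-! ### Ascending filtrations and associated graded rings -/

/-- An ascending multiplicative filtration `F 0 ⊆ F 1 ⊆ ...` of a commutative ring by
`ℤ`-submodules. -/
structure RingFiltration (R : Type*) [CommRing R] where
  F : ℕ → Submodule ℤ R
  mono : Monotone F
  one_mem : (1 : R) ∈ F 0
  mul_mem : ∀ {c d : ℕ} {f g : R}, f ∈ F c → g ∈ F d → f * g ∈ F (c + d)

namespace RingFiltration

variable {R : Type*} [CommRing R] (𝓕 : RingFiltration R)

/-- The step before `F d`, with the convention `F (-1) = 0`. -/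
def prev : ℕ → Submodule ℤ R
  | 0 => ⊥
  | d + 1 => 𝓕.F d

theorem mul_prev_mem {c d : ℕ} {f g : R} (hf : f ∈ 𝓕.F c) (hg : g ∈ 𝓕.prev d) :
    f * g ∈ 𝓕.prev (c + d) := by
  cases d with
  | zero =>
    have h0 : g = 0 := by simpa [prev] using hg
    subst h0
    simp
  | succ d => exact 𝓕.mul_mem hf hg

/-- The graded piece `F d / F (d - 1)`. -/
abbrev Piece (d : ℕ) : Type _ := 𝓕.F d ⧸ (𝓕.prev d).submoduleOf (𝓕.F d)

/-- The class in `F d / F (d - 1)` of an element of `F d`. -/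
def toPiece (d : ℕ) (f : R) (hf : f ∈ 𝓕.F d) : 𝓕.Piece d :=
  Submodule.Quotient.mk ⟨f, hf⟩

/-- Multiplication `F c / F (c - 1) × F d / F (d - 1) → F (c + d) / F (c + d - 1)`, induced by
the multiplication of representatives. -/
def pieceMul {c d : ℕ} (a : 𝓕.Piece c) (b : 𝓕.Piece d) : 𝓕.Piece (c + d) :=
  Quotient.liftOn₂' a b
    (fun f g => 𝓕.toPiece (c + d) (f.1 * g.1) (𝓕.mul_mem f.2 g.2))
    (by
      intro f g f' g' h h'
      rw [Submodule.quotientRel_def] at h h'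
      refine (Submodule.Quotient.eq _).2 ?_
      change f.1 * g.1 - f'.1 * g'.1 ∈ 𝓕.prev (c + d)
      have h1 : f.1 - f'.1 ∈ 𝓕.prev c := h
      have h2 : g.1 - g'.1 ∈ 𝓕.prev d := h'
      have e : f.1 * g.1 - f'.1 * g'.1 = g.1 * (f.1 - f'.1) + f'.1 * (g.1 - g'.1) := by ring
      rw [e]
      refine add_mem ?_ (𝓕.mul_prev_mem f'.2 h2)
      rw [add_comm c d]
      exact 𝓕.mul_prev_mem g.2 h1)

theorem exists_rep {d : ℕ} (a : 𝓕.Piece d) : ∃ f hf, a = 𝓕.toPiece d f hf := by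
  obtain ⟨f, rfl⟩ := Submodule.Quotient.mk_surjective _ a
  exact ⟨f.1, f.2, rfl⟩

theorem toPiece_add {d : ℕ} {f g : R} (hf : f ∈ 𝓕.F d) (hg : g ∈ 𝓕.F d) :
    𝓕.toPiece d f hf + 𝓕.toPiece d g hg = 𝓕.toPiece d (f + g) (add_mem hf hg) := rfl

theorem toPiece_zero {d : ℕ} : 𝓕.toPiece d 0 (zero_mem _) = 0 := rfl

theorem toPiece_congr {d : ℕ} {f g : R} (hf : f ∈ 𝓕.F d) (h : f = g) :
    𝓕.toPiece d f hf = 𝓕.toPiece d g (h ▸ hf) := by subst h; rfl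

theorem mk_toPiece_congr {c d : ℕ} {f g : R} (hf : f ∈ 𝓕.F c) (hg : g ∈ 𝓕.F d)
    (hcd : c = d) (h : f = g) :
    GradedMonoid.mk (A := 𝓕.Piece) c (𝓕.toPiece c f hf)
      = GradedMonoid.mk d (𝓕.toPiece d g hg) := by
  subst hcd; subst h; rfl

instance instGMul : GradedMonoid.GMul 𝓕.Piece where
  mul a b := 𝓕.pieceMul a b

instance instGOne : GradedMonoid.GOne 𝓕.Piece where
  one := 𝓕.toPiece 0 1 𝓕.one_mem

theorem mul_toPiece {c d : ℕ} {f g : R} (hf : f ∈ 𝓕.F c) (hg : g ∈ 𝓕.F d) :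
    GradedMonoid.GMul.mul (𝓕.toPiece c f hf) (𝓕.toPiece d g hg)
      = 𝓕.toPiece (c + d) (f * g) (𝓕.mul_mem hf hg) := rfl

instance instGCommRing : DirectSum.GCommRing 𝓕.Piece where
  toGMul := 𝓕.instGMul
  toGOne := 𝓕.instGOne
  mul_zero := by
    intro c d a
    obtain ⟨f, hf, rfl⟩ := 𝓕.exists_rep a
    rw [← toPiece_zero, mul_toPiece, 𝓕.toPiece_congr _ (mul_zero f), toPiece_zero]
  zero_mul := by
    intro c d a
    obtain ⟨f, hf, rfl⟩ := 𝓕.exists_rep a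
    rw [← toPiece_zero, mul_toPiece, 𝓕.toPiece_congr _ (zero_mul f), toPiece_zero]
  mul_add := by
    intro c d a b b'
    obtain ⟨f, hf, rfl⟩ := 𝓕.exists_rep a
    obtain ⟨g, hg, rfl⟩ := 𝓕.exists_rep b
    obtain ⟨g', hg', rfl⟩ := 𝓕.exists_rep b'
    simp only [toPiece_add, mul_toPiece]
    exact 𝓕.toPiece_congr _ (mul_add f g g')
  add_mul := by
    intro c d a a' b
    obtain ⟨f, hf, rfl⟩ := 𝓕.exists_rep a
    obtain ⟨f', hf', rfl⟩ := 𝓕.exists_rep a'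
    obtain ⟨g, hg, rfl⟩ := 𝓕.exists_rep b
    simp only [toPiece_add, mul_toPiece]
    exact 𝓕.toPiece_congr _ (add_mul f f' g)
  one_mul := by
    rintro ⟨d, a⟩
    obtain ⟨f, hf, rfl⟩ := 𝓕.exists_rep a
    exact 𝓕.mk_toPiece_congr _ _ (zero_add d) (one_mul f)
  mul_one := by
    rintro ⟨d, a⟩
    obtain ⟨f, hf, rfl⟩ := 𝓕.exists_rep a
    exact 𝓕.mk_toPiece_congr _ _ (add_zero d) (mul_one f)
  mul_assoc := by
    rintro ⟨c, a⟩ ⟨d, b⟩ ⟨e, k⟩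
    obtain ⟨f, hf, rfl⟩ := 𝓕.exists_rep a
    obtain ⟨g, hg, rfl⟩ := 𝓕.exists_rep b
    obtain ⟨h, hh, rfl⟩ := 𝓕.exists_rep k
    exact 𝓕.mk_toPiece_congr (𝓕.mul_mem (𝓕.mul_mem hf hg) hh)
      (𝓕.mul_mem hf (𝓕.mul_mem hg hh)) (add_assoc c d e) (mul_assoc f g h)
  mul_comm := by
    rintro ⟨c, a⟩ ⟨d, b⟩
    obtain ⟨f, hf, rfl⟩ := 𝓕.exists_rep a
    obtain ⟨g, hg, rfl⟩ := 𝓕.exists_rep b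
    exact 𝓕.mk_toPiece_congr (𝓕.mul_mem hf hg) (𝓕.mul_mem hg hf) (add_comm c d) (mul_comm f g)
  natCast k := k • 𝓕.toPiece 0 1 𝓕.one_mem
  natCast_zero := zero_smul _ _
  natCast_succ k := succ_nsmul _ _
  intCast k := k • 𝓕.toPiece 0 1 𝓕.one_mem
  intCast_ofNat k := natCast_zsmul _ _
  intCast_negSucc_ofNat k := negSucc_zsmul _ _

/-- The associated graded ring `⨁ d, F d / F (d - 1)`. -/
def Gr : Type _ := ⨁ d, 𝓕.Piece d

instance : CommRing 𝓕.Gr := inferInstanceAs (CommRing (⨁ d, 𝓕.Piece d))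

/-- The homogeneous element of degree `d` of the associated graded ring given by the class of
`f ∈ F d` in `F d / F (d - 1)`. -/
def toGr (d : ℕ) (f : R) (hf : f ∈ 𝓕.F d) : 𝓕.Gr :=
  DirectSum.of 𝓕.Piece d (𝓕.toPiece d f hf)

/-- The Hilbert series `∑ d, rank_ℤ (F d / F (d - 1)) t ^ d`. -/
def hilbertSeries : PowerSeries ℤ :=
  PowerSeries.mk fun d => (Module.finrank ℤ (𝓕.Piece d) : ℤ)

end RingFiltration

/-! ### Degree-initial forms -/

/-- The degree-initial form: the sum of the terms of top total degree. -/
def inDeg {σ : Type*} (f : MvPolynomial σ ℤ) : MvPolynomial σ ℤ :=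
  MvPolynomial.homogeneousComponent f.totalDegree f

/-- The monomial order refines the (partial) order of monomials by total degree. -/
def RefinesDegree {σ : Type*} (m : MonomialOrder σ) : Prop :=
  ∀ a b : σ →₀ ℕ, a.degree < b.degree → m.toSyn a < m.toSyn b

/-- The squarefree monomial `e_S`. -/
def sqfreeMonomial {n : ℕ} (S : Finset (Fin n)) : MvPolynomial (Fin n) ℤ :=
  ∏ i ∈ S, MvPolynomial.X i

/-- An ordered pair of disjoint subsets of `[n]`. -/
structure SignedSet (n : ℕ) where
  pos : Finset (Fin n)
  neg : Finset (Fin n)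
  disj : Disjoint pos neg

/-- The underlying unsigned set. -/
def SignedSet.support {n : ℕ} (C : SignedSet n) : Finset (Fin n) := C.pos ∪ C.neg

/-! ### Central arrangements and cones -/

/-- A central arrangement of `n` distinct hyperplanes in `ℝ^ℓ`, with a chosen normal vector for
each hyperplane. -/
structure CentralArrangement (ℓ n : ℕ) where
  normal : Fin n → EuclideanSpace ℝ (Fin ℓ)
  normal_ne_zero : ∀ i, normal i ≠ 0
  hyperplane_injective : Function.Injective fun i => (ℝ ∙ normal i)ᗮ

namespace CentralArrangement

variable {ℓ n : ℕ} (A : CentralArrangement ℓ n)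

/-- The hyperplane `H_i`, the orthogonal complement of the normal vector. -/
def hyperplane (i : Fin n) : Submodule ℝ (EuclideanSpace ℝ (Fin ℓ)) := (ℝ ∙ A.normal i)ᗮ

/-- The open positive halfspace `H_i^+`. -/
def posHalfspace (i : Fin n) : Set (EuclideanSpace ℝ (Fin ℓ)) :=
  {x | 0 < inner ℝ (A.normal i) x}

/-- The complement of the union of the hyperplanes. -/
def complement : Set (EuclideanSpace ℝ (Fin ℓ)) :=
  (⋃ i, (A.hyperplane i : Set (EuclideanSpace ℝ (Fin ℓ))))ᶜ

/-- The chambers of the arrangement: connected components of the complement. -/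
def chambers : Set (Set (EuclideanSpace ℝ (Fin ℓ))) :=
  {C | ∃ x ∈ A.complement, C = connectedComponentIn A.complement x}

/-- The cone `⋂ i ∈ W, H_i^+`. -/
def cone (W : Finset (Fin n)) : Set (EuclideanSpace ℝ (Fin ℓ)) :=
  ⋂ i ∈ W, A.posHalfspace i

/-- The chambers of the cone: chambers of the arrangement that lie inside the cone. -/
def coneChambers (W : Finset (Fin n)) : Set (Set (EuclideanSpace ℝ (Fin ℓ))) :=
  {C | C ∈ A.chambers ∧ C ⊆ A.cone W}

/-- The Varchenko-Gel'fand ring of the cone, with pointwise operations. -/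
abbrev VG (W : Finset (Fin n)) : Type := A.coneChambers W → ℤ

open Classical in
/-- The Heaviside function `x_i`. -/
def heaviside (W : Finset (Fin n)) (i : Fin n) : A.VG W :=
  fun C => if C.1 ⊆ A.posHalfspace i then 1 else 0

/-- The degree filtration: `F d` is the `ℤ`-span of products of at most `d` Heaviside functions. -/
def degreeFiltration (W : Finset (Fin n)) : RingFiltration (A.VG W) where
  F d := Submodule.span ℤ
    {f | ∃ a : Fin n → ℕ, ∑ i, a i ≤ d ∧ f = ∏ i, A.heaviside W i ^ a i}
  mono := by
    intro c d h
    refine Submodule.span_mono ?_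
    rintro f ⟨a, ha, rfl⟩
    exact ⟨a, ha.trans h, rfl⟩
  one_mem := Submodule.subset_span ⟨0, by simp, by simp⟩
  mul_mem := by
    intro c d f g hf hg
    induction hf, hg using Submodule.span_induction₂ with
    | mem_mem x y hx hy =>
      obtain ⟨a, ha, rfl⟩ := hx
      obtain ⟨b, hb, rfl⟩ := hy
      refine Submodule.subset_span ⟨a + b, ?_, ?_⟩
      · simpa [Finset.sum_add_distrib] using add_le_add ha hb
      · simp [pow_add, Finset.prod_mul_distrib]
    | zero_left y hy => simp
    | zero_right x hx => simp
    | add_left x y z hx hy hz h1 h2 => rw [add_mul]; exact add_mem h1 h2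
    | add_right x y z hx hy hz h1 h2 => rw [mul_add]; exact add_mem h1 h2
    | smul_left r x y hx hy h => rw [smul_mul_assoc]; exact Submodule.smul_mem _ r h
    | smul_right r x y hx hy h => rw [mul_smul_comm]; exact Submodule.smul_mem _ r h

theorem heaviside_mem (W : Finset (Fin n)) (i : Fin n) :
    A.heaviside W i ∈ (A.degreeFiltration W).F 1 := by
  refine Submodule.subset_span ⟨Pi.single i 1, by simp, ?_⟩
  rw [Finset.prod_eq_single i] <;> simp +contextual

/-- The associated graded ring of the Varchenko-Gel'fand ring of the cone. -/
abbrev GrVG (W : Finset (Fin n)) : Type := (A.degreeFiltration W).Gr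

/-- The class of the Heaviside function `x_i` in `F 1 / F 0`. -/
def grHeaviside (W : Finset (Fin n)) (i : Fin n) : A.GrVG W :=
  (A.degreeFiltration W).toGr 1 (A.heaviside W i) (A.heaviside_mem W i)

/-! ### Signed circuits and the relations -/

/-- `D` is the sign pattern of a linear dependence among the normal vectors. -/
def IsSignedDependency (D : SignedSet n) : Prop :=
  ∃ c : Fin n → ℝ, ∑ i, c i • A.normal i = 0 ∧
    (∀ i, i ∈ D.pos ↔ 0 < c i) ∧ ∀ i, i ∈ D.neg ↔ c i < 0

/-- A signed circuit: a nonempty signed dependency whose support is minimal under inclusion. -/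
def IsSignedCircuit (C : SignedSet n) : Prop :=
  A.IsSignedDependency C ∧ C.support.Nonempty ∧
    ∀ D : SignedSet n, A.IsSignedDependency D → D.support.Nonempty →
      D.support ⊆ C.support → D.support = C.support

open MvPolynomial in
/-- (Idempotent) -/
def idempotentRelations (n : ℕ) : Set (MvPolynomial (Fin n) ℤ) :=
  {g | ∃ i : Fin n, g = X i ^ 2 - X i}

open MvPolynomial in
/-- (Unit) -/
def unitRelations (W : Finset (Fin n)) : Set (MvPolynomial (Fin n) ℤ) :=
  {g | ∃ i ∈ W, g = X i - 1}

open MvPolynomial in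
/-- (Cone-Circuit), for the circuits that meet the walls only on one side. -/
def coneCircuitRelations (W : Finset (Fin n)) : Set (MvPolynomial (Fin n) ℤ) :=
  {g | ∃ C : SignedSet n, A.IsSignedCircuit C ∧
    (((W ∩ C.pos).Nonempty ∧ W ∩ C.pos = W ∩ C.support ∧
        g = sqfreeMonomial (C.pos \ W) * ∏ j ∈ C.neg, (X j - 1)) ∨
     ((W ∩ C.neg).Nonempty ∧ W ∩ C.neg = W ∩ C.support ∧
        g = sqfreeMonomial (C.neg \ W) * ∏ j ∈ C.pos, (X j - 1)))}

open MvPolynomial in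
/-- (Circuit), for the circuits that do not meet the walls. -/
def circuitRelations (W : Finset (Fin n)) : Set (MvPolynomial (Fin n) ℤ) :=
  {g | ∃ C : SignedSet n, A.IsSignedCircuit C ∧ W ∩ C.support = ∅ ∧
    g = sqfreeMonomial C.pos * ∏ j ∈ C.neg, (X j - 1)
      - sqfreeMonomial C.neg * ∏ j ∈ C.pos, (X j - 1)}

/-- The full set of relations `𝓖`. -/
def relations (W : Finset (Fin n)) : Set (MvPolynomial (Fin n) ℤ) :=
  idempotentRelations n ∪ unitRelations W ∪ A.coneCircuitRelations W ∪ A.circuitRelations W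

/-! ### Intersections and the Poincaré polynomial -/

/-- The intersections of the arrangement (the empty intersection being the whole space). -/
def intersections : Set (Submodule ℝ (EuclideanSpace ℝ (Fin ℓ))) :=
  Set.range fun S : Finset (Fin n) => ⨅ i ∈ S, A.hyperplane i

/-- The interior intersections: those that cut through the cone. -/
def interiorIntersections (W : Finset (Fin n)) :
    Set (Submodule ℝ (EuclideanSpace ℝ (Fin ℓ))) :=
  {X | X ∈ A.intersections ∧ ((X : Set (EuclideanSpace ℝ (Fin ℓ))) ∩ A.cone W).Nonempty}

/-- The poset of interior intersections, ordered by reverse inclusion. -/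
abbrev IntPoset (W : Finset (Fin n)) : Type :=
  {X : (Submodule ℝ (EuclideanSpace ℝ (Fin ℓ)))ᵒᵈ //
    OrderDual.ofDual X ∈ A.interiorIntersections W}

instance instFiniteIntPoset (W : Finset (Fin n)) : Finite (A.IntPoset W) := by
  have h : (A.interiorIntersections W).Finite :=
    (Set.finite_range fun S : Finset (Fin n) => ⨅ i ∈ S, A.hyperplane i).subset fun _ hX => hX.1
  exact h.to_subtype

instance instFintypeIntPoset (W : Finset (Fin n)) : Fintype (A.IntPoset W) := Fintype.ofFinite _

open Classical in
instance instLocallyFiniteOrderIntPoset (W : Finset (Fin n)) :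
    LocallyFiniteOrder (A.IntPoset W) := Fintype.toLocallyFiniteOrder

/-- The whole space, as an element of the poset of interior intersections as soon as that poset
has an element. -/
def wholeSpace (W : Finset (Fin n)) (X : A.IntPoset W) : A.IntPoset W :=
  ⟨OrderDual.toDual ⊤, ⟨∅, by simp⟩, X.2.2.mono fun _ hx => ⟨trivial, hx.2⟩⟩

open Classical in
/-- The Poincaré polynomial `∑ X, |μ(V, X)| t ^ codim X` of the cone. -/
def poincare (W : Finset (Fin n)) : Polynomial ℤ :=
  ∑ X : A.IntPoset W,
    Polynomial.C |IncidenceAlgebra.mu ℤ (A.wholeSpace W X) X| *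
      Polynomial.X ^ Module.finrank ℝ
        (EuclideanSpace ℝ (Fin ℓ) ⧸ (OrderDual.ofDual X.1))

/-! ### No broken circuit sets -/

/-- `B` is a broken circuit: a circuit with its smallest element removed. The elements of `[n]`
are compared through the monomial order, `i` being smaller than `j` when `e_i ≺ e_j`. -/
def IsBrokenCircuit (m : MonomialOrder (Fin n)) (B : Finset (Fin n)) : Prop :=
  ∃ C : SignedSet n, A.IsSignedCircuit C ∧ ∃ i₀ ∈ C.support,
    (∀ j ∈ C.support, m.toSyn (Finsupp.single i₀ 1) ≤ m.toSyn (Finsupp.single j 1)) ∧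
    B = C.support.erase i₀

open Classical in
/-- The `𝓚`-NBC sets: subsets of `[n]` that contain no broken circuit and whose intersection of
hyperplanes cuts through the cone. -/
def nbc (m : MonomialOrder (Fin n)) (W : Finset (Fin n)) : Finset (Finset (Fin n)) :=
  Finset.univ.filter fun N =>
    (∀ B, A.IsBrokenCircuit m B → ¬ B ⊆ N) ∧
      (⨅ i ∈ N, A.hyperplane i) ∈ A.interiorIntersections W

end CentralArrangement

end

namespace CentralArrangement

variable {ℓ n : ℕ} (A : CentralArrangement ℓ n)

/-! ### Chambers and sign vectors -/

/-! The NBC monomials span both quotient rings and are linearly independent on the chambers. The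
presentations, the bases and the Hilbert series follow from these two facts, without counting
chambers.

Spanning: no point has the signs of a nonempty dependency (`IsSignedDependency.not_signs`), so the
relations vanish on the Heaviside functions. Conversely, if N is not NBC for the cone, then N
contains an element of W, or all of C \ W for a circuit C meeting W on one side only, or the broken
circuit of a circuit avoiding W (`exists_obstruction`). The second case is Gordan's alternative,
proved by Hahn-Banach, followed by shrinking a dependency to a circuit. Each case supplies a
relation whose initial form has a leading monomial dividing e_N, with coefficient ±1, so e_N reduces
to smaller monomials modulo either ideal (`monomialReduces_of_notMem_nbc`). As the order refines
degree, F_d is spanned by the NBC products of at most d factors.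

Independence: start at a point of the cone on the flat of an NBC set N, move in a generic direction
of the flat, then along dual vectors with prescribed signs, at higher order in t for larger
elements. This gives chambers indexed by subsets of N (`exists_chamber_system`). Their alternating
sum is nonzero on the product over N and kills every other product of no larger weight
(`exists_detecting_functional`), so a triangularity argument applies.

Graded ring: the basis is adapted to the filtration, so its classes form a basis of the graded ring
(`RingFiltration.exists_basis_gr`), where the initial forms of the relations vanish
(`RingFiltration.aeval_inDeg_eq_zero`).

Poincaré polynomial: toggling the smallest hyperplane through X shows that signed NBC counts satisfy
the Möbius recursion (`mu_eq_sum_nbc`). NBC sets with flat X all have codim X elements, so taking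
the absolute value counts them. -/

theorem mem_hyperplane {i : Fin n} {x : EuclideanSpace ℝ (Fin ℓ)} :
    x ∈ A.hyperplane i ↔ inner ℝ (A.normal i) x = 0 :=
  Submodule.mem_orthogonal_singleton_iff_inner_right

theorem mem_iInf_hyperplane {N : Finset (Fin n)} {x : EuclideanSpace ℝ (Fin ℓ)} :
    x ∈ (⨅ i ∈ N, A.hyperplane i) ↔ ∀ i ∈ N, inner ℝ (A.normal i) x = 0 := by
  simp [Submodule.mem_iInf, mem_hyperplane]

theorem mem_complement {x : EuclideanSpace ℝ (Fin ℓ)} :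
    x ∈ A.complement ↔ ∀ i, inner ℝ (A.normal i) x ≠ 0 := by
  simp [complement, mem_hyperplane]

theorem mem_cone {W : Finset (Fin n)} {x : EuclideanSpace ℝ (Fin ℓ)} :
    x ∈ A.cone W ↔ ∀ i ∈ W, 0 < inner ℝ (A.normal i) x := by
  simp [cone, posHalfspace]

/-- By the intermediate value theorem, a change of sign on a connected set would force a zero, and
the complement contains none. -/
theorem inner_pos_iff_of_mem_component {x y : EuclideanSpace ℝ (Fin ℓ)}
    (hy : y ∈ connectedComponentIn A.complement x) (hx : x ∈ A.complement) (i : Fin n) :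
    0 < inner ℝ (A.normal i) y ↔ 0 < inner ℝ (A.normal i) x := by
  have hcont : Continuous fun z : EuclideanSpace ℝ (Fin ℓ) => inner ℝ (A.normal i) z := by
    fun_prop
  have key : ∀ a ∈ connectedComponentIn A.complement x,
      ∀ b ∈ connectedComponentIn A.complement x,
      0 < inner ℝ (A.normal i) a → 0 < inner ℝ (A.normal i) b := by
    intro a ha b hb hpos
    by_contra hneg
    have h := (isPreconnected_connectedComponentIn (F := A.complement) (x := x)).intermediate_value
      hb ha hcont.continuousOn
    obtain ⟨z, hz, hz0⟩ := h ⟨not_lt.1 hneg, hpos.le⟩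
    exact A.mem_complement.1 (connectedComponentIn_subset _ _ hz) i hz0
  have hxx := mem_connectedComponentIn hx
  exact ⟨key y hy x hxx, key x hxx y hy⟩

/-- The segment between two points with equal signs crosses no hyperplane. Hence chambers are the
same thing as realized sign vectors. -/
theorem component_eq_of_signs {x y : EuclideanSpace ℝ (Fin ℓ)} (hx : x ∈ A.complement)
    (hy : y ∈ A.complement)
    (h : ∀ i, 0 < inner ℝ (A.normal i) x ↔ 0 < inner ℝ (A.normal i) y) :
    connectedComponentIn A.complement x = connectedComponentIn A.complement y := by
  have hsub : segment ℝ x y ⊆ A.complement := by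
    rintro z ⟨a, b, ha, hb, hab, rfl⟩
    rw [mem_complement] at hx hy ⊢
    intro i
    rw [inner_add_right, inner_smul_right, inner_smul_right]
    rcases lt_or_gt_of_ne (hx i) with hi | hi
    · have hi' : inner ℝ (A.normal i) y < 0 :=
        lt_of_le_of_ne (not_lt.1 fun hc => hi.not_gt ((h i).2 hc)) (hy i)
      rcases ha.eq_or_lt with rfl | ha
      · have : b = 1 := by linarith
        subst this; simpa using hy i
      · have := mul_neg_of_pos_of_neg ha hi
        have := mul_nonpos_of_nonneg_of_nonpos hb hi'.le
        linarith
    · have hi' := (h i).1 hi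
      rcases ha.eq_or_lt with rfl | ha
      · have : b = 1 := by linarith
        subst this; simpa using hy i
      · have := mul_pos ha hi
        have := mul_nonneg hb hi'.le
        linarith
  refine connectedComponentIn_eq ?_
  exact (convex_segment x y).isPreconnected.subset_connectedComponentIn
    (left_mem_segment ℝ x y) hsub (right_mem_segment ℝ x y)

variable {A} in
/-- The chamber of the cone that contains a given point. -/
def chamberAt {W : Finset (Fin n)} {x : EuclideanSpace ℝ (Fin ℓ)} (hx : x ∈ A.complement)
    (hW : x ∈ A.cone W) : A.coneChambers W :=
  ⟨connectedComponentIn A.complement x, ⟨x, hx, rfl⟩, fun _ hy => A.mem_cone.2 fun i hi =>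
    (A.inner_pos_iff_of_mem_component hy hx i).2 (A.mem_cone.1 hW i hi)⟩

theorem heaviside_chamberAt {W : Finset (Fin n)} {x : EuclideanSpace ℝ (Fin ℓ)}
    (hx : x ∈ A.complement) (hW : x ∈ A.cone W) (i : Fin n) :
    A.heaviside W i (chamberAt hx hW) = if 0 < inner ℝ (A.normal i) x then 1 else 0 := by
  have : (chamberAt hx hW).1 ⊆ A.posHalfspace i ↔ 0 < inner ℝ (A.normal i) x :=
    ⟨fun h => h (mem_connectedComponentIn hx),
      fun h y hy => (A.inner_pos_iff_of_mem_component hy hx i).2 h⟩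
  simp only [heaviside, this]

theorem exists_eq_chamberAt {W : Finset (Fin n)} (C : A.coneChambers W) :
    ∃ (x : EuclideanSpace ℝ (Fin ℓ)) (hx : x ∈ A.complement) (hW : x ∈ A.cone W),
      C = chamberAt hx hW := by
  obtain ⟨C, ⟨x, hx, rfl⟩, hC⟩ := C
  exact ⟨x, hx, hC (mem_connectedComponentIn hx), rfl⟩

theorem heaviside_eq_zero_or_one {W : Finset (Fin n)} (C : A.coneChambers W) (i : Fin n) :
    A.heaviside W i C = 0 ∨ A.heaviside W i C = 1 := by
  unfold heaviside
  split_ifs <;> simp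

theorem coneChambers_ext {W : Finset (Fin n)} {C D : A.coneChambers W}
    (h : ∀ i, A.heaviside W i C = 1 ↔ A.heaviside W i D = 1) : C = D := by
  obtain ⟨x, hx, hxW, rfl⟩ := A.exists_eq_chamberAt C
  obtain ⟨y, hy, hyW, rfl⟩ := A.exists_eq_chamberAt D
  refine Subtype.ext (A.component_eq_of_signs hx hy fun i => ?_)
  have := h i
  rw [heaviside_chamberAt, heaviside_chamberAt] at this
  simpa using this

instance finite_coneChambers (W : Finset (Fin n)) : Finite (A.coneChambers W) := by
  refine Finite.of_injective (fun C => {i | A.heaviside W i C = 1}) fun C D h => ?_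
  exact A.coneChambers_ext fun i => Set.ext_iff.1 h i

/-! ### The relations hold among the Heaviside functions -/

theorem heaviside_of_mem {W : Finset (Fin n)} {i : Fin n} (hi : i ∈ W) :
    A.heaviside W i = 1 := by
  funext C
  obtain ⟨x, hx, hxW, rfl⟩ := A.exists_eq_chamberAt C
  rw [heaviside_chamberAt, if_pos (A.mem_cone.1 hxW i hi)]
  rfl

/-- No point lies on the positive side of all hyperplanes in the positive part and on the negative
side of all hyperplanes in the negative part of a signed dependency. -/
theorem IsSignedDependency.not_signs {D : SignedSet n} (hD : A.IsSignedDependency D)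
    (hne : D.support.Nonempty) (x : EuclideanSpace ℝ (Fin ℓ)) :
    ¬ ((∀ i ∈ D.pos, 0 < inner ℝ (A.normal i) x) ∧ ∀ i ∈ D.neg, inner ℝ (A.normal i) x < 0) := by
  rintro ⟨hp, hn⟩
  obtain ⟨c, hc, hcp, hcn⟩ := hD
  have h0 : ∑ i, c i * inner ℝ (A.normal i) x = 0 := by
    have := congrArg (fun v => inner ℝ v x) hc
    simpa [sum_inner, inner_smul_left] using this
  have hnn : ∀ i, 0 ≤ c i * inner ℝ (A.normal i) x := by
    intro i
    rcases lt_trichotomy (c i) 0 with h | h | h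
    · exact (mul_pos_of_neg_of_neg h (hn i ((hcn i).2 h))).le
    · simp [h]
    · exact (mul_pos h (hp i ((hcp i).2 h))).le
  rw [Finset.sum_eq_zero_iff_of_nonneg fun i _ => hnn i] at h0
  obtain ⟨i, hi⟩ := hne
  have h1 := h0 i (Finset.mem_univ i)
  rcases Finset.mem_union.1 hi with hi | hi
  · exact (mul_pos ((hcp i).1 hi) (hp i hi)).ne' h1
  · exact (mul_pos_of_neg_of_neg ((hcn i).1 hi) (hn i hi)).ne' h1

/-- The negative of a signed set. -/
def _root_.SignedSet.swap (D : SignedSet n) : SignedSet n := ⟨D.neg, D.pos, D.disj.symm⟩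

theorem _root_.SignedSet.support_swap (D : SignedSet n) : D.swap.support = D.support :=
  Finset.union_comm _ _

theorem IsSignedDependency.swap {D : SignedSet n} (hD : A.IsSignedDependency D) :
    A.IsSignedDependency D.swap := by
  obtain ⟨c, hc, hcp, hcn⟩ := hD
  refine ⟨-c, by simp [hc], fun i => ?_, fun i => ?_⟩
  · simpa [SignedSet.swap] using hcn i
  · simpa [SignedSet.swap] using hcp i

theorem IsSignedCircuit.swap {D : SignedSet n} (hD : A.IsSignedCircuit D) :
    A.IsSignedCircuit D.swap := by
  obtain ⟨h1, h2, h3⟩ := hD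
  rw [← D.support_swap] at h2
  exact ⟨h1.swap, h2, by rwa [D.support_swap]⟩

/-- A chamber where no factor vanishes would carry the forbidden signs of D. Factors indexed by W
can be omitted because those signs are automatic in the cone. -/
theorem IsSignedDependency.prod_heaviside_eq_zero {D : SignedSet n}
    (hD : A.IsSignedDependency D) (hne : D.support.Nonempty) (W : Finset (Fin n)) :
    (∏ i ∈ D.pos \ W, A.heaviside W i) * ∏ j ∈ D.neg, (A.heaviside W j - 1) = 0 := by
  funext C
  obtain ⟨x, hx, hxW, rfl⟩ := A.exists_eq_chamberAt C
  by_contra h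
  simp only [Pi.mul_apply, Finset.prod_apply, Pi.sub_apply, Pi.one_apply, heaviside_chamberAt,
    Pi.zero_apply, mul_eq_zero, not_or, Finset.prod_eq_zero_iff, not_exists, not_and] at h
  refine hD.not_signs A hne x ⟨fun i hi => ?_, fun i hi => ?_⟩
  · by_cases hiW : i ∈ W
    · exact A.mem_cone.1 hxW i hiW
    · by_contra hc
      exact h.1 i (Finset.mem_sdiff.2 ⟨hi, hiW⟩) (if_neg hc)
  · refine lt_of_le_of_ne (not_lt.1 fun hc => h.2 i hi ?_) (A.mem_complement.1 hx i)
    rw [if_pos hc, sub_self]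

open MvPolynomial in
theorem aeval_heaviside_eq_zero {W : Finset (Fin n)} {g : MvPolynomial (Fin n) ℤ}
    (hg : g ∈ A.relations W) : aeval (A.heaviside W) g = 0 := by
  rcases hg with ((⟨i, rfl⟩ | ⟨i, hi, rfl⟩) | ⟨C, hC, h⟩) | ⟨C, hC, hW, rfl⟩
  · funext D
    rcases A.heaviside_eq_zero_or_one D i with h | h <;> simp [h]
  · simp [A.heaviside_of_mem hi]
  · rcases h with ⟨-, h, rfl⟩ | ⟨-, h, rfl⟩
    · simpa [sqfreeMonomial] using hC.1.prod_heaviside_eq_zero A hC.2.1 W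
    · have hS := hC.swap
      simpa [sqfreeMonomial, SignedSet.swap] using hS.1.prod_heaviside_eq_zero A hS.2.1 W
  -- The two terms of the circuit relation vanish separately, one by the circuit and the other by
  -- its negative.
  · have hS := hC.swap
    have hd : Disjoint W C.support := Finset.disjoint_iff_inter_eq_empty.2 hW
    have hp := hd.mono_right (Finset.subset_union_left : C.pos ⊆ C.support)
    have hn := hd.mono_right (Finset.subset_union_right : C.neg ⊆ C.support)
    have h1 := hC.1.prod_heaviside_eq_zero A hC.2.1 W
    have h2 := hS.1.prod_heaviside_eq_zero A hS.2.1 W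
    rw [Finset.sdiff_eq_self_of_disjoint hp.symm] at h1
    rw [show C.swap.pos = C.neg from rfl, show C.swap.neg = C.pos from rfl,
      Finset.sdiff_eq_self_of_disjoint hn.symm] at h2
    simp [sqfreeMonomial, h1, h2]

end CentralArrangement

namespace CentralArrangement

variable {ℓ n : ℕ} (A : CentralArrangement ℓ n)

/-! ### Circuits inside dependencies -/

/-- The signed set of a real vector. -/
noncomputable def _root_.SignedSet.ofVector (c : Fin n → ℝ) : SignedSet n where
  pos := {i | 0 < c i}
  neg := {i | c i < 0}
  disj := Finset.disjoint_left.2 fun i h1 h2 => by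
    simp only [Finset.mem_filter, Finset.mem_univ, true_and] at h1 h2
    exact h1.not_gt h2

@[simp] theorem _root_.SignedSet.mem_pos_ofVector {c : Fin n → ℝ} {i : Fin n} :
    i ∈ (SignedSet.ofVector c).pos ↔ 0 < c i := by simp [SignedSet.ofVector]

@[simp] theorem _root_.SignedSet.mem_neg_ofVector {c : Fin n → ℝ} {i : Fin n} :
    i ∈ (SignedSet.ofVector c).neg ↔ c i < 0 := by simp [SignedSet.ofVector]

@[simp] theorem _root_.SignedSet.mem_support_ofVector {c : Fin n → ℝ} {i : Fin n} :
    i ∈ (SignedSet.ofVector c).support ↔ c i ≠ 0 := by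
  simp [SignedSet.support, lt_or_lt_iff_ne, or_comm]

theorem isSignedDependency_ofVector {c : Fin n → ℝ} (hc : ∑ i, c i • A.normal i = 0) :
    A.IsSignedDependency (SignedSet.ofVector c) :=
  ⟨c, hc, fun _ => SignedSet.mem_pos_ofVector, fun _ => SignedSet.mem_neg_ofVector⟩

theorem IsSignedDependency.exists_vector {D : SignedSet n} (hD : A.IsSignedDependency D) :
    ∃ c : Fin n → ℝ, ∑ i, c i • A.normal i = 0 ∧ (∀ i, i ∈ D.support ↔ c i ≠ 0) ∧
      (∀ i, i ∈ D.pos ↔ 0 < c i) ∧ ∀ i, i ∈ D.neg ↔ c i < 0 := by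
  obtain ⟨c, hc, hp, hn⟩ := hD
  refine ⟨c, hc, fun i => ?_, hp, hn⟩
  rw [SignedSet.support, Finset.mem_union, hp, hn, or_comm, lt_or_lt_iff_ne]

/-- The predicate is left open so that supports can also be minimized under sign conditions on W. -/
theorem exists_minimal_dependency {P : (Fin n → ℝ) → Prop} {c : Fin n → ℝ} (hP : P c) :
    ∃ d, P d ∧ ∀ e, P e → (SignedSet.ofVector e).support ⊆ (SignedSet.ofVector d).support →
      (SignedSet.ofVector e).support = (SignedSet.ofVector d).support := by
  obtain ⟨d, hd, hmin⟩ := WellFounded.has_min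
    (InvImage.wf (fun c : Fin n → ℝ => (SignedSet.ofVector c).support.card) wellFounded_lt)
    {c | P c} ⟨c, hP⟩
  refine ⟨d, hd, fun e he hsub => ?_⟩
  exact Finset.eq_of_subset_of_card_le hsub (not_lt.1 (hmin e he))

theorem exists_circuit_of_dependency {c : Fin n → ℝ} (hc : ∑ i, c i • A.normal i = 0)
    {i₀ : Fin n} (h0 : c i₀ ≠ 0) :
    ∃ C : SignedSet n, A.IsSignedCircuit C ∧ ∀ i ∈ C.support, c i ≠ 0 := by
  obtain ⟨d, ⟨hd, ⟨j, hj⟩, hdc⟩, hmin⟩ := exists_minimal_dependency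
    (P := fun d => ∑ i, d i • A.normal i = 0 ∧ (∃ j, d j ≠ 0) ∧ ∀ i, d i ≠ 0 → c i ≠ 0)
    ⟨hc, ⟨i₀, h0⟩, fun _ => id⟩
  refine ⟨SignedSet.ofVector d, ⟨A.isSignedDependency_ofVector hd,
    ⟨j, SignedSet.mem_support_ofVector.2 hj⟩, fun D hD ⟨k, hk⟩ hsub => ?_⟩,
    fun i hi => hdc i (SignedSet.mem_support_ofVector.1 hi)⟩
  obtain ⟨e, he, hes, -⟩ := hD.exists_vector
  have hDe : D.support = (SignedSet.ofVector e).support := by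
    ext i; rw [hes, SignedSet.mem_support_ofVector]
  rw [hDe] at hsub ⊢
  exact hmin e ⟨he, ⟨k, (hes k).1 hk⟩, fun i hi => hdc i (SignedSet.mem_support_ofVector.1
    (hsub (SignedSet.mem_support_ofVector.2 hi)))⟩ hsub

/-- A dependency that is nonnegative and nonzero on `W` contains a circuit that meets `W`
only in its positive part. -/
theorem exists_circuit_pos_on {W : Finset (Fin n)} {c : Fin n → ℝ}
    (hc : ∑ i, c i • A.normal i = 0) (hW : ∀ i ∈ W, 0 ≤ c i) {i₀ : Fin n} (hi₀ : i₀ ∈ W)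
    (h0 : c i₀ ≠ 0) :
    ∃ C : SignedSet n, A.IsSignedCircuit C ∧ (∀ i ∈ C.support, c i ≠ 0) ∧
      (W ∩ C.pos).Nonempty ∧ W ∩ C.pos = W ∩ C.support := by
  -- Minimality is imposed only among dependencies that are nonnegative and nonzero on W. `key`
  -- upgrades it to minimality among all nonzero dependencies, after replacing `e` by `-e` if it
  -- takes a negative value on W.
  obtain ⟨d, ⟨hd, hdW, ⟨j, hjW, hj⟩, hdc⟩, hmin⟩ := exists_minimal_dependency
    (P := fun d => ∑ i, d i • A.normal i = 0 ∧ (∀ i ∈ W, 0 ≤ d i) ∧ (∃ j ∈ W, d j ≠ 0) ∧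
      ∀ i, d i ≠ 0 → c i ≠ 0)
    ⟨hc, hW, ⟨i₀, hi₀, h0⟩, fun _ => id⟩
  have hsubset : ∀ e : Fin n → ℝ, (∀ i, e i ≠ 0 → d i ≠ 0) →
      (SignedSet.ofVector e).support ⊆ (SignedSet.ofVector d).support := fun e he i hi =>
    SignedSet.mem_support_ofVector.2 (he i (SignedSet.mem_support_ofVector.1 hi))
  -- a dependency inside the support that vanishes on `W` or takes a positive value there has
  -- full support
  have key : ∀ e : Fin n → ℝ, ∑ i, e i • A.normal i = 0 → (∀ i, e i ≠ 0 → d i ≠ 0) →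
      (∃ k, e k ≠ 0) → ((∀ i ∈ W, e i = 0) ∨ ∃ i ∈ W, 0 < e i) → ∀ i, d i ≠ 0 → e i ≠ 0 := by
    intro e he hed hk hcase
    -- subtracting a multiple of `e` that kills a coordinate of `d`
    have step : ∀ s : ℝ, ∀ k, e k ≠ 0 → d k = s * e k → (∀ i ∈ W, s * e i ≤ d i) →
        (∃ i ∈ W, d i ≠ s * e i) → False := by
      intro s k hk hdk hle hne
      have hsup : ∀ i, d i - s * e i ≠ 0 → d i ≠ 0 := by
        intro i hi hdi
        by_cases hei : e i = 0
        · simp [hdi, hei] at hi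
        · exact hed i hei hdi
      have := hmin (fun i => d i - s * e i)
        ⟨by simp [sub_smul, mul_smul, ← Finset.smul_sum, hd, he],
          fun i hi => sub_nonneg.2 (hle i hi),
          hne.imp fun i hi => ⟨hi.1, sub_ne_zero.2 hi.2⟩, fun i hi => hdc i (hsup i hi)⟩
        (hsubset _ hsup)
      have hmem : k ∈ (SignedSet.ofVector d).support :=
        SignedSet.mem_support_ofVector.2 (hed k hk)
      rw [← this, SignedSet.mem_support_ofVector] at hmem
      exact hmem (sub_eq_zero.2 hdk)
    rcases hcase with h | ⟨i₁, hi₁, hpos⟩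
    · obtain ⟨k, hk⟩ := hk
      refine (step (d k / e k) k hk (by field_simp) (fun i hi => ?_) ⟨j, hjW, ?_⟩).elim
      · rw [h i hi, mul_zero]; exact hdW i hi
      · rw [h j hjW, mul_zero]; exact hj
    -- The smallest ratio d i / e i over W with e i > 0 is the largest multiple of `e` that can be
    -- subtracted while staying nonnegative on W.
    · obtain ⟨k, hk, hkmin⟩ := Finset.exists_min_image (W.filter fun i => 0 < e i)
        (fun i => d i / e i) ⟨i₁, Finset.mem_filter.2 ⟨hi₁, hpos⟩⟩
      rw [Finset.mem_filter] at hk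
      have hs : 0 < d k / e k := div_pos
        (lt_of_le_of_ne (hdW k hk.1) (hed k hk.2.ne').symm) hk.2
      have hle : ∀ i ∈ W, d k / e k * e i ≤ d i := by
        intro i hi
        rcases le_or_gt (e i) 0 with hei | hei
        · exact (mul_nonpos_of_nonneg_of_nonpos hs.le hei).trans (hdW i hi)
        · exact (le_div_iff₀ hei).1 (hkmin i (Finset.mem_filter.2 ⟨hi, hei⟩))
      by_cases hne : ∃ i ∈ W, d i ≠ d k / e k * e i
      · exact (step (d k / e k) k hk.2.ne' (div_mul_cancel₀ _ hk.2.ne').symm hle hne).elim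
      -- Now `d` is a positive multiple of `e` on W, so `e` is itself an admissible competitor.
      · push Not at hne
        have := hmin e ⟨he, fun i hi => ?_, ⟨k, hk.1, hk.2.ne'⟩, fun i hi => hdc i (hed i hi)⟩
          (hsubset _ hed)
        · intro i hi
          rwa [← SignedSet.mem_support_ofVector, this, SignedSet.mem_support_ofVector]
        · have h1 := hdW i hi
          rw [hne i hi] at h1
          exact nonneg_of_mul_nonneg_right h1 hs
  refine ⟨SignedSet.ofVector d, ⟨A.isSignedDependency_ofVector hd,
    ⟨j, SignedSet.mem_support_ofVector.2 hj⟩, fun D hD ⟨k, hk⟩ hsub => ?_⟩,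
    fun i hi => hdc i (SignedSet.mem_support_ofVector.1 hi),
    ⟨j, Finset.mem_inter.2 ⟨hjW, SignedSet.mem_pos_ofVector.2 (lt_of_le_of_ne (hdW j hjW) hj.symm)⟩⟩,
    ?_⟩
  · obtain ⟨e, he, hes, -⟩ := hD.exists_vector
    refine hsub.antisymm fun i hi => (hes i).2 ?_
    have hed : ∀ i, e i ≠ 0 → d i ≠ 0 := fun i hi =>
      SignedSet.mem_support_ofVector.1 (hsub ((hes i).2 hi))
    rw [SignedSet.mem_support_ofVector] at hi
    have hk' := (hes k).1 hk
    by_cases hz : ∀ i ∈ W, e i = 0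
    · exact key e he hed ⟨k, hk'⟩ (Or.inl hz) i hi
    · push Not at hz
      obtain ⟨a, ha, hea⟩ := hz
      rcases lt_or_gt_of_ne hea with hlt | hgt
      · have := key (-e) (by simp [he]) (by simpa using hed) ⟨k, by simpa using hk'⟩
          (Or.inr ⟨a, ha, by simpa using hlt⟩) i hi
        simpa using this
      · exact key e he hed ⟨k, hk'⟩ (Or.inr ⟨a, ha, hgt⟩) i hi
  · ext i
    simp only [Finset.mem_inter, SignedSet.mem_pos_ofVector, SignedSet.mem_support_ofVector]
    exact and_congr_right fun hi => ⟨fun h => h.ne', fun h => lt_of_le_of_ne (hdW i hi) h.symm⟩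

/-- Gordan's alternative: if a flat misses the cone, then some nonnegative nonzero combination
of the normals of the walls is a combination of normals of the flat. -/
theorem exists_dependency_of_disjoint {N W : Finset (Fin n)}
    (h : ¬ (((⨅ i ∈ N, A.hyperplane i : Submodule ℝ (EuclideanSpace ℝ (Fin ℓ))) :
      Set (EuclideanSpace ℝ (Fin ℓ))) ∩ A.cone W).Nonempty) (hNW : Disjoint N W) :
    ∃ c : Fin n → ℝ, ∑ i, c i • A.normal i = 0 ∧ (∀ i ∈ W, 0 ≤ c i) ∧ (∃ i ∈ W, c i ≠ 0) ∧
      ∀ i, c i ≠ 0 → i ∈ W ∪ N := by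
  classical
  set K := convexHull ℝ (W.image A.normal : Set (EuclideanSpace ℝ (Fin ℓ))) with hK
  set U : Submodule ℝ (EuclideanSpace ℝ (Fin ℓ)) := Submodule.span ℝ (A.normal '' N) with hU
  by_cases hd : Disjoint K (U : Set (EuclideanSpace ℝ (Fin ℓ)))
  · exfalso
    obtain ⟨f, u, v, hf, huv, hv⟩ := geometric_hahn_banach_compact_closed (convex_convexHull ℝ _)
      ((Finset.finite_toSet _).isCompact_convexHull ℝ) U.convex
      U.closed_of_finiteDimensional hd
    have hv0 : v < 0 := by simpa using hv 0 U.zero_mem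
    -- A functional bounded below on a subspace vanishes there: otherwise some multiple of x would
    -- take the excluded value v.
    have hfU : ∀ x ∈ U, f x = 0 := by
      intro x hx
      by_contra hne
      have := hv ((v / f x) • x) (U.smul_mem _ hx)
      rw [map_smul, smul_eq_mul, div_mul_cancel₀ _ hne] at this
      exact lt_irrefl _ this
    -- The negative of the Riesz representative of f is orthogonal to the normals of N and positive
    -- on those of W, since f < 0 on K: a point of the flat inside the cone.
    set y := (InnerProductSpace.toDual ℝ (EuclideanSpace ℝ (Fin ℓ))).symm f with hy
    have hfy : ∀ x, inner ℝ x y = f x := fun x => by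
      rw [real_inner_comm, hy, InnerProductSpace.toDual_symm_apply]
    refine h ⟨-y, A.mem_iInf_hyperplane.2 fun i hi => ?_, A.mem_cone.2 fun i hi => ?_⟩
    · rw [inner_neg_right, hfy, hfU _ (Submodule.subset_span ⟨i, hi, rfl⟩), neg_zero]
    · rw [inner_neg_right, hfy]
      have := hf (A.normal i) (subset_convexHull ℝ _ (by simpa using ⟨i, hi, rfl⟩))
      linarith
  · obtain ⟨x, hxK, hxU⟩ := Set.not_disjoint_iff.1 hd
    rw [SetLike.mem_coe, hU, Submodule.mem_span_image_finset_iff_exists_fun'] at hxU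
    obtain ⟨b, hb⟩ := hxU
    obtain ⟨w, hw0, hw1, hw⟩ := Finset.mem_convexHull'.1 hxK
    -- Distinct hyperplanes have distinct normals, so weights on the set of normals can be read as
    -- weights on indices.
    have hinj : Set.InjOn A.normal W := fun i _ j _ h =>
      A.hyperplane_injective (congrArg
        (fun v => ((Submodule.span ℝ {v})ᗮ : Submodule ℝ (EuclideanSpace ℝ (Fin ℓ)))) h)
    rw [Finset.sum_image hinj] at hw1 hw
    have hdisj : ∀ i ∈ N, i ∉ W := fun i hi => Finset.disjoint_left.1 hNW hi
    have hdisj' : ∀ i ∈ W, i ∉ N := fun i hi hi' => hdisj i hi' hi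
    refine ⟨fun i => (if i ∈ W then w (A.normal i) else 0) - if i ∈ N then b i else 0,
      ?_, fun i hi => ?_, ?_, fun i hi => ?_⟩
    · simp only [sub_smul, ite_smul, zero_smul, Finset.sum_sub_distrib, Finset.sum_ite_mem,
        Finset.univ_inter, hw, hb, sub_self]
    · simpa [hi, hdisj' i hi] using hw0 _ (Finset.mem_image_of_mem _ hi)
    · by_contra hne
      push Not at hne
      rw [Finset.sum_eq_zero fun i hi => by simpa [hi, hdisj' i hi] using hne i hi] at hw1
      exact zero_ne_one hw1
    · by_contra hc
      rw [Finset.mem_union, not_or] at hc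
      simp [hc.1, hc.2] at hi

end CentralArrangement

section Polynomials

open MvPolynomial

/-! ### Squarefree monomials and initial forms -/

section InitialForms

variable {n : ℕ}

/-- The exponent vector of `e_S`. -/
noncomputable def sqfreeExponent (S : Finset (Fin n)) : Fin n →₀ ℕ :=
  ∑ i ∈ S, Finsupp.single i 1

theorem sqfreeMonomial_eq_monomial (S : Finset (Fin n)) :
    sqfreeMonomial S = monomial (sqfreeExponent S) 1 := by
  rw [sqfreeExponent, monomial_sum_one]
  rfl

theorem sqfreeExponent_apply (S : Finset (Fin n)) (i : Fin n) :
    sqfreeExponent S i = if i ∈ S then 1 else 0 := by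
  simp [sqfreeExponent, Finsupp.finsetSum_apply, Finsupp.single_apply]

theorem sqfreeExponent_injective :
    Function.Injective (sqfreeExponent : Finset (Fin n) → Fin n →₀ ℕ) := by
  intro S T h
  ext i
  have := DFunLike.congr_fun h i
  rw [sqfreeExponent_apply, sqfreeExponent_apply] at this
  by_cases hS : i ∈ S <;> by_cases hT : i ∈ T <;> simp_all

theorem degree_sqfreeExponent (S : Finset (Fin n)) : (sqfreeExponent S).degree = S.card := by
  simp [sqfreeExponent, map_sum]

theorem sqfreeMonomial_mul {S T : Finset (Fin n)} (h : Disjoint S T) :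
    sqfreeMonomial S * sqfreeMonomial T = sqfreeMonomial (S ∪ T) :=
  (Finset.prod_union h).symm

theorem sqfreeExponent_mono {S T : Finset (Fin n)} (h : S ⊆ T) :
    sqfreeExponent S ≤ sqfreeExponent T :=
  Finset.sum_le_sum_of_subset h

theorem sqfreeExponent_erase_add {S : Finset (Fin n)} {i : Fin n} (h : i ∈ S) :
    sqfreeExponent (S.erase i) + Finsupp.single i 1 = sqfreeExponent S :=
  Finset.sum_erase_add _ _ h

theorem monomial_mul_mem_restrictSupport {σ : Type*} {s t : Set (σ →₀ ℕ)} {p : MvPolynomial σ ℤ}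
    (hp : p ∈ restrictSupport ℤ s) (a : σ →₀ ℕ) (h : ∀ b ∈ s, a + b ∈ t) :
    monomial a 1 * p ∈ restrictSupport ℤ t := by
  rw [restrictSupport_eq_span] at hp
  induction hp using Submodule.span_induction with
  | mem x hx =>
    obtain ⟨b, hb, rfl⟩ := hx
    rw [monomial_mul, one_mul]
    exact (monomial_mem_restrictSupport ℤ).2 (Or.inl (h b hb))
  | zero => rw [mul_zero]; exact zero_mem _
  | add x y _ _ hx hy => rw [mul_add]; exact add_mem hx hy
  | smul c x _ hx => rw [mul_smul_comm]; exact Submodule.smul_mem _ c hx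

theorem inDeg_eq_of_eq_add {σ : Type*} {g t r : MvPolynomial σ ℤ} {k : ℕ} (hg : g = t + r)
    (ht : t.IsHomogeneous k) (ht0 : t ≠ 0) (hr : r ∈ restrictSupport ℤ {b | b.degree < k}) :
    inDeg g = t := by
  have hr0 : ∀ d : σ →₀ ℕ, k ≤ d.degree → coeff d r = 0 := by
    intro d hd
    by_contra hne
    exact (hr (mem_support_iff.2 hne)).not_ge hd
  have hcomp : homogeneousComponent k g = t := by
    ext d
    rw [coeff_homogeneousComponent]
    split_ifs with hd
    · rw [hg, coeff_add, hr0 d hd.ge, add_zero]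
    · exact (ht.coeff_eq_zero hd).symm
  have hdeg : g.totalDegree = k := by
    refine le_antisymm ?_ ?_
    · refine Finset.sup_le fun d hd => ?_
      change d.degree ≤ k
      by_contra hlt
      rw [not_le] at hlt
      refine mem_support_iff.1 hd ?_
      rw [hg, coeff_add, hr0 d hlt.le, add_zero, ht.coeff_eq_zero hlt.ne']
    · obtain ⟨d, hd⟩ := exists_coeff_ne_zero ht0
      have hdk : d.degree = k := by
        by_contra hne
        exact hd (ht.coeff_eq_zero hne)
      have : d ∈ g.support := by
        rw [mem_support_iff, hg, coeff_add, hr0 d hdk.ge, add_zero]; exact hd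
      have := le_totalDegree this
      rw [← hdk]; exact this
  rw [inDeg, hdeg, hcomp]

theorem isHomogeneous_sqfreeMonomial (S : Finset (Fin n)) :
    (sqfreeMonomial S).IsHomogeneous S.card := by
  rw [sqfreeMonomial_eq_monomial]
  exact isHomogeneous_monomial _ (degree_sqfreeExponent S)

theorem sqfreeMonomial_ne_zero (S : Finset (Fin n)) : sqfreeMonomial S ≠ 0 := by
  rw [sqfreeMonomial_eq_monomial, Ne, monomial_eq_zero]
  exact one_ne_zero

theorem sqfreeMonomial_mem_restrictSupport {S : Finset (Fin n)} {s : Set (Fin n →₀ ℕ)}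
    (h : sqfreeExponent S ∈ s) : sqfreeMonomial S ∈ restrictSupport ℤ s := by
  rw [sqfreeMonomial_eq_monomial]
  exact (monomial_mem_restrictSupport ℤ).2 (Or.inl h)

/-- The two leading homogeneous parts of `∏ j ∈ S, (e_j - 1)`. -/
theorem exists_prod_X_sub_one (S : Finset (Fin n)) :
    ∃ r ∈ restrictSupport ℤ {b : Fin n →₀ ℕ | b.degree + 2 ≤ S.card},
      ∏ j ∈ S, (X j - 1 : MvPolynomial (Fin n) ℤ)
        = sqfreeMonomial S - ∑ j ∈ S, sqfreeMonomial (S.erase j) + r := by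
  induction S using Finset.induction_on with
  | empty => exact ⟨0, zero_mem _, by simp [sqfreeMonomial]⟩
  | insert a S ha ih =>
    obtain ⟨r, hr, hS⟩ := ih
    refine ⟨X a * r + ∑ j ∈ S, sqfreeMonomial (S.erase j) - r, ?_, ?_⟩
    · rw [Finset.card_insert_of_notMem ha]
      refine sub_mem (add_mem ?_ (sum_mem fun j hj => ?_)) ?_
      · refine monomial_mul_mem_restrictSupport hr (Finsupp.single a 1) fun b hb => ?_
        simp only [Set.mem_ofPred_eq, map_add, Finsupp.degree_single] at hb ⊢
        omega
      · refine sqfreeMonomial_mem_restrictSupport ?_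
        have := Finset.card_erase_of_mem hj
        have := Finset.card_pos.2 ⟨j, hj⟩
        simp only [Set.mem_ofPred_eq, degree_sqfreeExponent]
        omega
      · refine restrictSupport_mono ℤ (fun b hb => ?_) hr
        simp only [Set.mem_ofPred_eq] at hb ⊢
        omega
    · have h1 : ∀ j ∈ S, sqfreeMonomial ((insert a S).erase j)
          = X a * sqfreeMonomial (S.erase j) := by
        intro j hj
        have hne : j ≠ a := fun h => ha (h ▸ hj)
        rw [Finset.erase_insert_of_ne hne.symm]
        exact Finset.prod_insert fun h => ha (Finset.mem_of_mem_erase h)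
      rw [Finset.prod_insert ha, hS, Finset.sum_insert ha, Finset.erase_insert ha,
        Finset.sum_congr rfl h1, ← Finset.mul_sum,
        show sqfreeMonomial (insert a S) = X a * sqfreeMonomial S from Finset.prod_insert ha]
      ring

theorem inDeg_idempotent (i : Fin n) : inDeg (X i ^ 2 - X i) = X i ^ 2 := by
  refine inDeg_eq_of_eq_add (k := 2) (sub_eq_add_neg _ _) (isHomogeneous_X_pow i 2)
    (pow_ne_zero 2 (X_ne_zero i)) (neg_mem ?_)
  exact (monomial_mem_restrictSupport ℤ).2 (Or.inl (by simp))

theorem inDeg_unit (i : Fin n) : inDeg (X i - 1) = X i := by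
  refine inDeg_eq_of_eq_add (k := 1) (sub_eq_add_neg _ _) (isHomogeneous_X ℤ i)
    (X_ne_zero i) (neg_mem ?_)
  exact (monomial_mem_restrictSupport ℤ).2 (Or.inl (by simp))

theorem inDeg_sqfreeMonomial_mul_prod {S T : Finset (Fin n)} (h : Disjoint S T) :
    inDeg (sqfreeMonomial S * ∏ j ∈ T, (X j - 1)) = sqfreeMonomial (S ∪ T) := by
  obtain ⟨r, hr, hT⟩ := exists_prod_X_sub_one T
  refine inDeg_eq_of_eq_add (k := (S ∪ T).card)
    (r := sqfreeMonomial S * (r - ∑ j ∈ T, sqfreeMonomial (T.erase j))) ?_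
    (isHomogeneous_sqfreeMonomial _) (sqfreeMonomial_ne_zero _) ?_
  · rw [hT, ← sqfreeMonomial_mul h]; ring
  · rw [sqfreeMonomial_eq_monomial]
    refine monomial_mul_mem_restrictSupport (s := {b | b.degree < T.card}) (sub_mem ?_ ?_) _ ?_
    · refine restrictSupport_mono ℤ (fun b hb => ?_) hr
      simp only [Set.mem_ofPred_eq] at hb ⊢
      omega
    · refine sum_mem fun j hj => sqfreeMonomial_mem_restrictSupport ?_
      simpa [degree_sqfreeExponent] using Finset.card_erase_lt_of_mem hj
    · intro b hb
      simp only [Set.mem_ofPred_eq, map_add, degree_sqfreeExponent, Finset.card_union_of_disjoint h]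
        at hb ⊢
      omega

/-- The initial form of the circuit relation. -/
noncomputable def circuitInitialForm (C : SignedSet n) : MvPolynomial (Fin n) ℤ :=
  ∑ j ∈ C.pos, sqfreeMonomial (C.support.erase j) - ∑ j ∈ C.neg, sqfreeMonomial (C.support.erase j)

/-- Different j give different monomials, so nothing collects. That the coefficients are units is
what lets the reduction run over the integers. -/
theorem coeff_circuitInitialForm (C : SignedSet n) {i : Fin n} (hi : i ∈ C.support) :
    coeff (sqfreeExponent (C.support.erase i)) (circuitInitialForm C)
      = if i ∈ C.pos then 1 else -1 := by
  have hcoeff : ∀ j ∈ C.support, coeff (sqfreeExponent (C.support.erase i))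
      (sqfreeMonomial (C.support.erase j)) = if j = i then 1 else 0 := by
    intro j hj
    rw [sqfreeMonomial_eq_monomial, coeff_monomial]
    refine if_congr ⟨fun h => ?_, fun h => by rw [h]⟩ rfl rfl
    exact Finset.erase_injOn _ hj hi (sqfreeExponent_injective h)
  rw [circuitInitialForm, coeff_sub, coeff_sum, coeff_sum,
    Finset.sum_congr rfl fun j hj => hcoeff j (Finset.mem_union_left _ hj),
    Finset.sum_congr rfl fun j hj => hcoeff j (Finset.mem_union_right _ hj),
    Finset.sum_ite_eq', Finset.sum_ite_eq']
  rcases Finset.mem_union.1 hi with h | h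
  · simp [h, Finset.disjoint_left.1 C.disj h]
  · simp [h, Finset.disjoint_right.1 C.disj h]

/-- Both products have the same top term, the full monomial of the circuit. It cancels, the degree
drops by one, and the second-highest parts become the initial form. -/
theorem inDeg_circuit {C : SignedSet n} (hC : C.support.Nonempty) :
    inDeg (sqfreeMonomial C.pos * ∏ j ∈ C.neg, (X j - 1)
      - sqfreeMonomial C.neg * ∏ j ∈ C.pos, (X j - 1)) = circuitInitialForm C := by
  obtain ⟨r, hr, hn⟩ := exists_prod_X_sub_one C.neg
  obtain ⟨s, hs, hp⟩ := exists_prod_X_sub_one C.pos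
  obtain ⟨i, hi⟩ := hC
  have hcard : C.support.card = C.pos.card + C.neg.card := Finset.card_union_of_disjoint C.disj
  have hpos : 0 < C.support.card := Finset.card_pos.2 ⟨i, hi⟩
  refine inDeg_eq_of_eq_add (k := C.support.card - 1)
    (r := sqfreeMonomial C.pos * r - sqfreeMonomial C.neg * s) ?_ ?_ ?_ (sub_mem ?_ ?_)
  · rw [hn, hp]
    have h1 : ∀ j ∈ C.pos, sqfreeMonomial (C.support.erase j)
        = sqfreeMonomial C.neg * sqfreeMonomial (C.pos.erase j) := by
      intro j hj
      rw [sqfreeMonomial_mul (C.disj.symm.mono_right (Finset.erase_subset _ _)),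
        SignedSet.support, Finset.union_comm, Finset.erase_union_distrib,
        Finset.erase_eq_of_notMem (Finset.disjoint_left.1 C.disj hj)]
    have h2 : ∀ j ∈ C.neg, sqfreeMonomial (C.support.erase j)
        = sqfreeMonomial C.pos * sqfreeMonomial (C.neg.erase j) := by
      intro j hj
      rw [sqfreeMonomial_mul (C.disj.mono_right (Finset.erase_subset _ _)),
        SignedSet.support, Finset.erase_union_distrib,
        Finset.erase_eq_of_notMem (Finset.disjoint_right.1 C.disj hj)]
    rw [circuitInitialForm, Finset.sum_congr rfl h1, Finset.sum_congr rfl h2, ← Finset.mul_sum,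
      ← Finset.mul_sum]
    ring
  · refine IsHomogeneous.sub (IsHomogeneous.sum _ _ _ fun j hj => ?_)
      (IsHomogeneous.sum _ _ _ fun j hj => ?_)
    · rw [← Finset.card_erase_of_mem (show j ∈ C.support from Finset.mem_union_left C.neg hj)]
      exact isHomogeneous_sqfreeMonomial _
    · rw [← Finset.card_erase_of_mem (show j ∈ C.support from Finset.mem_union_right C.pos hj)]
      exact isHomogeneous_sqfreeMonomial _
  · intro h
    have := coeff_circuitInitialForm C hi
    rw [h, coeff_zero] at this
    split_ifs at this
    all_goals simp at this
  · rw [sqfreeMonomial_eq_monomial]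
    refine monomial_mul_mem_restrictSupport hr _ fun b hb => ?_
    simp only [Set.mem_ofPred_eq, map_add, degree_sqfreeExponent] at hb ⊢
    omega
  · rw [sqfreeMonomial_eq_monomial]
    refine monomial_mul_mem_restrictSupport hs _ fun b hb => ?_
    simp only [Set.mem_ofPred_eq, map_add, degree_sqfreeExponent] at hb ⊢
    omega

end InitialForms

/-! ### Reduction of monomials modulo an ideal -/

section Reduction

variable {σ : Type*} (m : MonomialOrder σ)

/-- Modulo the ideal `I`, the monomial with exponent `a` is a combination of smaller ones. -/
def MonomialReduces (I : Ideal (MvPolynomial σ ℤ)) (a : σ →₀ ℕ) : Prop :=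
  ∃ q ∈ I, monomial a 1 - q ∈ restrictSupport ℤ {b | m.toSyn b < m.toSyn a}

variable {m}

theorem MonomialReduces.of_le {I : Ideal (MvPolynomial σ ℤ)} {a b : σ →₀ ℕ}
    (h : MonomialReduces m I a) (hab : a ≤ b) : MonomialReduces m I b := by
  obtain ⟨q, hq, hs⟩ := h
  refine ⟨monomial (b - a) 1 * q, I.mul_mem_left _ hq, ?_⟩
  have hb : b - a + a = b := tsub_add_cancel_of_le hab
  have : monomial b (1 : ℤ) = monomial (b - a) 1 * monomial a 1 := by
    rw [monomial_mul, hb, one_mul]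
  rw [this, ← mul_sub]
  refine monomial_mul_mem_restrictSupport hs _ fun c hc => ?_
  rw [Set.mem_ofPred_eq] at hc ⊢
  rw [← hb, map_add, map_add, hb]
  exact (add_lt_add_iff_left _).2 hc

/-- If the initial form of `g ∈ G`, up to sign, reduces a monomial, then so does `g`. -/
theorem MonomialReduces.of_inDeg (hm : RefinesDegree m) {G : Set (MvPolynomial σ ℤ)}
    {g : MvPolynomial σ ℤ} (hg : g ∈ G) {u : ℤ} {a : σ →₀ ℕ}
    (h : monomial a 1 - u • inDeg g ∈ restrictSupport ℤ {b | m.toSyn b < m.toSyn a}) :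
    MonomialReduces m (Ideal.span (inDeg '' G)) a ∧ MonomialReduces m (Ideal.span G) a := by
  classical
  refine ⟨⟨u • inDeg g, zsmul_mem (Ideal.subset_span (Set.mem_image_of_mem _ hg)) u, h⟩,
    ⟨u • g, zsmul_mem (Ideal.subset_span hg) u, ?_⟩⟩
  -- The monomial a does not survive in the difference, so it occurs in the initial form and has its
  -- degree. The other terms of g have lower degree and are therefore smaller than a.
  have hdeg : a.degree = g.totalDegree := by
    by_contra hne
    have h0 : coeff a (monomial a 1 - u • inDeg g) = 1 := by
      rw [coeff_sub, coeff_smul, inDeg, coeff_homogeneousComponent, if_neg hne, smul_zero, sub_zero,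
        coeff_monomial, if_pos rfl]
    have := h (mem_support_iff.2 (h0 ▸ one_ne_zero))
    exact lt_irrefl _ this
  have : monomial a 1 - u • g = (monomial a 1 - u • inDeg g) + u • (inDeg g - g) := by
    rw [smul_sub]; ring
  rw [this]
  refine add_mem h (Submodule.smul_mem _ _ ((mem_restrictSupport_iff ℤ).2 fun b hb => hm _ _ ?_))
  rw [Finset.mem_coe, mem_support_iff, coeff_sub, inDeg, coeff_homogeneousComponent] at hb
  split_ifs at hb with hbd
  · simp at hb
  · rw [zero_sub, neg_ne_zero] at hb
    have := le_totalDegree (mem_support_iff.2 hb)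
    rw [hdeg]
    exact lt_of_le_of_ne this hbd

/-- If every nonstandard monomial reduces, then the standard monomials span modulo the ideal. -/
theorem monomial_mem_sup_span {I : Ideal (MvPolynomial σ ℤ)} {s : Set (σ →₀ ℕ)}
    (h : ∀ a ∉ s, MonomialReduces m I a) (a : σ →₀ ℕ) :
    monomial a 1 ∈ I.restrictScalars ℤ ⊔
      restrictSupport ℤ {b | b ∈ s ∧ m.toSyn b ≤ m.toSyn a} := by
  induction ha : m.toSyn a using WellFoundedLT.induction generalizing a with
  | ind x ih =>
    subst ha
    by_cases has : a ∈ s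
    · exact Submodule.mem_sup_right ((monomial_mem_restrictSupport ℤ).2 (Or.inl ⟨has, le_rfl⟩))
    · obtain ⟨q, hq, hs⟩ := h a has
      rw [← sub_add_cancel (monomial a 1) q]
      refine add_mem ?_ (Submodule.mem_sup_left hq)
      rw [restrictSupport_eq_span] at hs
      refine Submodule.span_le.2 ?_ hs
      rintro _ ⟨b, hb, rfl⟩
      have := ih _ hb b rfl
      have hle : {c | c ∈ s ∧ m.toSyn c ≤ m.toSyn b} ⊆ {c | c ∈ s ∧ m.toSyn c ≤ m.toSyn a} :=
        fun c hc => ⟨hc.1, hc.2.trans (le_of_lt hb)⟩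
      exact sup_le_sup_left (restrictSupport_mono ℤ hle) _ this

end Reduction

end Polynomials

section Polynomials

open MvPolynomial

namespace CentralArrangement

variable {ℓ n : ℕ} (A : CentralArrangement ℓ n)

/-! ### Sets without broken circuits -/

theorem mem_nbc {m : MonomialOrder (Fin n)} {W N : Finset (Fin n)} :
    N ∈ A.nbc m W ↔ (∀ B, A.IsBrokenCircuit m B → ¬ B ⊆ N) ∧
      ∃ p ∈ A.cone W, ∀ i ∈ N, inner ℝ (A.normal i) p = 0 := by
  classical
  rw [nbc, Finset.mem_filter]
  refine (and_iff_right (Finset.mem_univ _)).trans (and_congr_right fun _ => ?_)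
  constructor
  · rintro ⟨-, p, hp, hpW⟩
    exact ⟨p, hpW, A.mem_iInf_hyperplane.1 hp⟩
  · rintro ⟨p, hpW, hp⟩
    exact ⟨⟨N, rfl⟩, p, A.mem_iInf_hyperplane.2 hp, hpW⟩

theorem IsSignedCircuit.exists_isLeast (m : MonomialOrder (Fin n)) {C : SignedSet n}
    (hC : A.IsSignedCircuit C) : ∃ i ∈ C.support, ∀ j ∈ C.support,
      m.toSyn (Finsupp.single i 1) ≤ m.toSyn (Finsupp.single j 1) :=
  Finset.exists_min_image C.support (fun i => m.toSyn (Finsupp.single i 1)) hC.2.1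

theorem toSyn_single_injective (m : MonomialOrder (Fin n)) :
    Function.Injective fun i : Fin n => m.toSyn (Finsupp.single i 1) := fun _ _ h =>
  Finsupp.single_left_injective one_ne_zero (m.toSyn.injective h)

/-- If all but one of the hyperplanes of a circuit contain `p`, then so does the last one. -/
theorem IsSignedCircuit.inner_eq_zero {C : SignedSet n} (hC : A.IsSignedCircuit C) {i : Fin n}
    (hi : i ∈ C.support) {p : EuclideanSpace ℝ (Fin ℓ)}
    (hp : ∀ j ∈ C.support.erase i, inner ℝ (A.normal j) p = 0) : inner ℝ (A.normal i) p = 0 := by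
  obtain ⟨c, hc, hs, -⟩ := hC.1.exists_vector
  have h0 : ∑ j, c j * inner ℝ (A.normal j) p = 0 := by
    have := congrArg (fun v => inner ℝ v p) hc
    simpa [sum_inner, inner_smul_left] using this
  rw [Finset.sum_eq_single i] at h0
  · exact (mul_eq_zero.1 h0).resolve_left ((hs i).1 hi)
  · intro j _ hj
    by_cases hcj : c j = 0
    · rw [hcj, zero_mul]
    · rw [hp j (Finset.mem_erase.2 ⟨hj, (hs j).2 hcj⟩), mul_zero]
  · exact fun h => absurd (Finset.mem_univ i) h

/-- A set of hyperplanes that is not an NBC set of the cone violates one of three conditions. -/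
theorem exists_obstruction {m : MonomialOrder (Fin n)} {W N : Finset (Fin n)}
    (hN : N ∉ A.nbc m W) :
    (∃ i ∈ N, i ∈ W) ∨
    (∃ C, A.IsSignedCircuit C ∧ (W ∩ C.pos).Nonempty ∧ W ∩ C.pos = W ∩ C.support ∧
      C.support \ W ⊆ N) ∨
    (∃ C, A.IsSignedCircuit C ∧ W ∩ C.support = ∅ ∧ ∃ i ∈ C.support,
      (∀ j ∈ C.support, m.toSyn (Finsupp.single i 1) ≤ m.toSyn (Finsupp.single j 1)) ∧
        C.support.erase i ⊆ N) := by
  by_cases hNW : Disjoint N W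
  swap
  · exact Or.inl (Finset.not_disjoint_iff.1 hNW)
  right
  by_cases hne : (((⨅ i ∈ N, A.hyperplane i : Submodule ℝ (EuclideanSpace ℝ (Fin ℓ))) :
      Set (EuclideanSpace ℝ (Fin ℓ))) ∩ A.cone W).Nonempty
  · right
    obtain ⟨p, hp, hpW⟩ := hne
    rw [SetLike.mem_coe, mem_iInf_hyperplane] at hp
    rw [mem_nbc, not_and] at hN
    have hb : ¬ ∀ B, A.IsBrokenCircuit m B → ¬ B ⊆ N := fun h => hN h ⟨p, hpW, hp⟩
    push Not at hb
    obtain ⟨B, ⟨C, hC, i, hi, hmin, rfl⟩, hB⟩ := hb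
    refine ⟨C, hC, ?_, i, hi, hmin, hB⟩
    -- All hyperplanes of the circuit pass through p, the omitted one included, whereas p is
    -- strictly positive on W.
    refine Finset.disjoint_iff_inter_eq_empty.1 (Finset.disjoint_left.2 fun j hjW hjC => ?_)
    refine (A.mem_cone.1 hpW j hjW).ne' ?_
    by_cases hji : j = i
    · subst hji
      exact hC.inner_eq_zero A hi fun k hk => hp k (hB hk)
    · exact hp j (hB (Finset.mem_erase.2 ⟨hji, hjC⟩))
  · left
    obtain ⟨c, hc, hcW, ⟨i, hi, hci⟩, hcs⟩ := A.exists_dependency_of_disjoint hne hNW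
    obtain ⟨C, hC, hCs, h1, h2⟩ := A.exists_circuit_pos_on hc hcW hi hci
    refine ⟨C, hC, h1, h2, fun j hj => ?_⟩
    rw [Finset.mem_sdiff] at hj
    exact (Finset.mem_union.1 (hcs j (hCs j hj.1))).resolve_left hj.2

/-- The three obstructions correspond to (Unit), (Cone-Circuit) and (Circuit). Their initial forms
are e_i, the monomial of C \ W, and a signed sum led by the broken circuit;
`MonomialReduces.of_inDeg` then serves both ideals at once. -/
theorem monomialReduces_of_notMem_nbc {m : MonomialOrder (Fin n)} (hm : RefinesDegree m)
    {W N : Finset (Fin n)} (hN : N ∉ A.nbc m W) :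
    MonomialReduces m (Ideal.span (inDeg '' A.relations W)) (sqfreeExponent N) ∧
      MonomialReduces m (Ideal.span (A.relations W)) (sqfreeExponent N) := by
  rcases A.exists_obstruction hN with ⟨i, hiN, hiW⟩ | ⟨C, hC, h1, h2, h3⟩ |
    ⟨C, hC, hCW, i, hi, hmin, hCN⟩
  · have hle : Finsupp.single i 1 ≤ sqfreeExponent N := by
      simpa [sqfreeExponent] using sqfreeExponent_mono (Finset.singleton_subset_iff.2 hiN)
    refine (MonomialReduces.of_inDeg hm (u := 1) (a := Finsupp.single i 1)
      (Or.inl (Or.inl (Or.inr ⟨i, hiW, rfl⟩))) ?_).imp (·.of_le hle) (·.of_le hle)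
    rw [inDeg_unit, one_smul]
    exact (sub_self (X i : MvPolynomial (Fin n) ℤ)).symm ▸ zero_mem _
  · have hsup : C.pos \ W ∪ C.neg = C.support \ W := by
      have : C.neg \ W = C.neg := by
        refine Finset.sdiff_eq_self_of_disjoint (Finset.disjoint_left.2 fun i hi hiW => ?_)
        have : i ∈ W ∩ C.pos := by
          rw [h2]; exact Finset.mem_inter.2 ⟨hiW, Finset.mem_union_right _ hi⟩
        exact Finset.disjoint_left.1 C.disj (Finset.mem_inter.1 this).2 hi
      rw [SignedSet.support, Finset.union_sdiff_distrib, this]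
    have hle := sqfreeExponent_mono h3
    refine (MonomialReduces.of_inDeg hm (u := 1) (a := sqfreeExponent (C.support \ W))
      (Or.inl (Or.inr ⟨C, hC, Or.inl ⟨h1, h2, rfl⟩⟩)) ?_).imp (·.of_le hle) (·.of_le hle)
    rw [inDeg_sqfreeMonomial_mul_prod (C.disj.mono_left Finset.sdiff_subset), hsup, one_smul,
      sqfreeMonomial_eq_monomial, sub_self]
    exact zero_mem _
  · have hle := sqfreeExponent_mono hCN
    refine (MonomialReduces.of_inDeg hm (u := if i ∈ C.pos then 1 else -1)
      (a := sqfreeExponent (C.support.erase i))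
      (Or.inr ⟨C, hC, hCW, rfl⟩) ?_).imp (·.of_le hle) (·.of_le hle)
    rw [inDeg_circuit hC.2.1]
    -- Omitting the smallest variable leaves the largest monomial, so the broken circuit leads.
    have hlt : ∀ j ∈ C.support, j ≠ i → m.toSyn (sqfreeExponent (C.support.erase j))
        < m.toSyn (sqfreeExponent (C.support.erase i)) := by
      intro j hj hji
      have h := (sqfreeExponent_erase_add hj).trans (sqfreeExponent_erase_add hi).symm
      have hlt : m.toSyn (Finsupp.single i 1) < m.toSyn (Finsupp.single j 1) :=
        lt_of_le_of_ne (hmin j hj) fun he => hji (toSyn_single_injective m he).symm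
      have h' := congrArg m.toSyn h
      rw [map_add, map_add] at h'
      by_contra hnot
      exact (add_lt_add_of_le_of_lt (not_lt.1 hnot) hlt).ne' h'
    rw [mem_restrictSupport_iff]
    intro b hb
    rw [Finset.mem_coe, mem_support_iff, coeff_sub, coeff_smul, coeff_monomial] at hb
    by_cases hbi : sqfreeExponent (C.support.erase i) = b
    · subst hbi
      rw [if_pos rfl, coeff_circuitInitialForm C hi] at hb
      split_ifs at hb
      all_goals simp at hb
    · rw [if_neg hbi, zero_sub, neg_ne_zero] at hb
      have hb' : coeff b (circuitInitialForm C) ≠ 0 := fun h => hb (by rw [h, smul_zero])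
      have hex : ∃ j ∈ C.support, sqfreeExponent (C.support.erase j) = b := by
        by_contra hno
        push Not at hno
        refine hb' ?_
        simp only [circuitInitialForm, sqfreeMonomial_eq_monomial, coeff_sub, coeff_sum,
          coeff_monomial]
        rw [Finset.sum_eq_zero fun j hj => if_neg (hno j (Finset.mem_union_left _ hj)),
          Finset.sum_eq_zero fun j hj => if_neg (hno j (Finset.mem_union_right _ hj)), sub_zero]
      obtain ⟨j, hj, rfl⟩ := hex
      exact hlt j hj fun h => hbi (by rw [h])

theorem monomialReduces_of_notMem {m : MonomialOrder (Fin n)} (hm : RefinesDegree m)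
    {W : Finset (Fin n)} {a : Fin n →₀ ℕ}
    (ha : a ∉ sqfreeExponent '' (A.nbc m W : Set (Finset (Fin n)))) :
    MonomialReduces m (Ideal.span (inDeg '' A.relations W)) a ∧
      MonomialReduces m (Ideal.span (A.relations W)) a := by
  by_cases h : ∃ i, 2 ≤ a i
  · obtain ⟨i, hi⟩ := h
    have hle : Finsupp.single i 2 ≤ a := Finsupp.single_le_iff.2 hi
    refine (MonomialReduces.of_inDeg hm (u := 1) (a := Finsupp.single i 2)
      (Or.inl (Or.inl (Or.inl ⟨i, rfl⟩))) ?_).imp (·.of_le hle) (·.of_le hle)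
    rw [inDeg_idempotent, one_smul, X_pow_eq_monomial, sub_self]
    exact zero_mem _
  · push Not at h
    have hsq : sqfreeExponent a.support = a := by
      ext i
      rw [sqfreeExponent_apply]
      have := h i
      split_ifs with hi
      · have := Finsupp.mem_support_iff.1 hi; omega
      · exact (Finsupp.notMem_support_iff.1 hi).symm
    rw [← hsq]
    refine A.monomialReduces_of_notMem_nbc hm fun hN => ha ⟨_, hN, hsq⟩

/-- Modulo either ideal, a monomial is a combination of NBC monomials of no larger degree. -/
theorem monomial_mem_sup_nbc {m : MonomialOrder (Fin n)} (hm : RefinesDegree m)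
    {W : Finset (Fin n)} {I : Ideal (MvPolynomial (Fin n) ℤ)}
    (hI : I = Ideal.span (inDeg '' A.relations W) ∨ I = Ideal.span (A.relations W))
    (a : Fin n →₀ ℕ) :
    monomial a 1 ∈ I.restrictScalars ℤ ⊔ Submodule.span ℤ
      (sqfreeMonomial '' {N | N ∈ A.nbc m W ∧ N.card ≤ a.degree}) := by
  have h := monomial_mem_sup_span (m := m) (I := I)
    (s := sqfreeExponent '' (A.nbc m W : Set (Finset (Fin n)))) (fun a ha => by
      rcases hI with rfl | rfl
      exacts [(A.monomialReduces_of_notMem hm ha).1, (A.monomialReduces_of_notMem hm ha).2]) a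
  rw [restrictSupport_eq_span] at h
  have hsub : (fun a => monomial a (1 : ℤ)) '' {b | b ∈ sqfreeExponent ''
      (A.nbc m W : Set (Finset (Fin n))) ∧ m.toSyn b ≤ m.toSyn a} ⊆
      sqfreeMonomial '' {N | N ∈ A.nbc m W ∧ N.card ≤ a.degree} := by
    rintro _ ⟨b, ⟨⟨N, hN, rfl⟩, hle⟩, rfl⟩
    refine ⟨N, ⟨hN, ?_⟩, sqfreeMonomial_eq_monomial N⟩
    rw [← degree_sqfreeExponent]
    by_contra hlt
    exact (hm _ _ (not_le.1 hlt)).not_ge hle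
  have hle := Submodule.span_mono (R := ℤ) hsub
  exact sup_le_sup_left hle _ h

end CentralArrangement

end Polynomials

namespace CentralArrangement

variable {ℓ n : ℕ} (A : CentralArrangement ℓ n)

/-! ### Linear independence of the NBC monomials -/

/-- The position of `e_i` among the variables, starting from one. -/
noncomputable def varRank (m : MonomialOrder (Fin n)) (i : Fin n) : ℕ :=
  (Finset.univ.filter fun j : Fin n =>
    m.toSyn (Finsupp.single j 1) ≤ m.toSyn (Finsupp.single i 1)).card

theorem varRank_lt_iff {m : MonomialOrder (Fin n)} {i j : Fin n} :
    varRank m i < varRank m j ↔ m.toSyn (Finsupp.single i 1) < m.toSyn (Finsupp.single j 1) := by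
  have h1 : ∀ i j : Fin n, m.toSyn (Finsupp.single i 1) ≤ m.toSyn (Finsupp.single j 1) →
      varRank m i ≤ varRank m j := fun i j h =>
    Finset.card_le_card fun k hk => by
      simp only [Finset.mem_filter, Finset.mem_univ, true_and] at hk ⊢
      exact hk.trans h
  refine ⟨fun h => not_le.1 fun hle => h.not_ge (h1 _ _ hle), fun h => ?_⟩
  refine Finset.card_lt_card (Finset.ssubset_iff_of_subset (fun k hk => ?_) |>.2 ⟨j, ?_, ?_⟩)
  · simp only [Finset.mem_filter, Finset.mem_univ, true_and] at hk ⊢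
    exact hk.trans h.le
  · simp
  · simpa using h

theorem varRank_injective (m : MonomialOrder (Fin n)) : Function.Injective (varRank m) := by
  intro i j h
  refine toSyn_single_injective m (le_antisymm ?_ ?_)
  · exact not_lt.1 fun hlt => (varRank_lt_iff.2 hlt).ne' h
  · exact not_lt.1 fun hlt => (varRank_lt_iff.2 hlt).ne h

/-- Positive ranks keep the exponents rank + 1 away from 0 and 1 in the perturbation, and make the
weight strictly increasing under inclusion. -/
theorem varRank_pos (m : MonomialOrder (Fin n)) (i : Fin n) : 0 < varRank m i :=
  Finset.card_pos.2 ⟨i, by simp⟩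

/-- A dependency supported on an NBC set and one more element `i` involves an element of rank
at most that of `i`. -/
theorem exists_rank_lt_of_dependency {m : MonomialOrder (Fin n)} {N : Finset (Fin n)}
    (hN : ∀ B, A.IsBrokenCircuit m B → ¬ B ⊆ N) {c : Fin n → ℝ}
    (hc : ∑ i, c i • A.normal i = 0) {i₀ : Fin n} (h0 : c i₀ ≠ 0)
    (hcN : ∀ j, c j ≠ 0 → j ∈ N ∨ j = i₀) :
    i₀ ∉ N ∧ ∃ k ∈ N, c k ≠ 0 ∧ varRank m k < varRank m i₀ := by
  -- The circuit minus its least element is not inside N. The element outside N can only be i₀, so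
  -- i₀ is not the least one, and the least one lies in N.
  obtain ⟨C, hC, hCs⟩ := A.exists_circuit_of_dependency hc h0
  obtain ⟨i, hi, hmin⟩ := hC.exists_isLeast A m
  have hnot := hN _ ⟨C, hC, i, hi, hmin, rfl⟩
  obtain ⟨j, hj, hjN⟩ := Finset.not_subset.1 hnot
  rw [Finset.mem_erase] at hj
  have hj0 : j = i₀ := (hcN j (hCs j hj.2)).resolve_left hjN
  subst hj0
  refine ⟨hjN, i, (hcN i (hCs i hi)).resolve_right hj.1.symm, hCs i hi, varRank_lt_iff.2 ?_⟩
  exact lt_of_le_of_ne (hmin j hj.2) fun h => hj.1 (toSyn_single_injective m h).symm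

theorem linearIndepOn_of_nbc {m : MonomialOrder (Fin n)} {N : Finset (Fin n)}
    (hN : ∀ B, A.IsBrokenCircuit m B → ¬ B ⊆ N) :
    LinearIndepOn ℝ A.normal (N : Set (Fin n)) := by
  rw [linearIndepOn_finset_iff]
  intro c hc i hi
  by_contra hne
  refine (A.exists_rank_lt_of_dependency hN (c := fun i => if i ∈ N then c i else 0) (i₀ := i)
    (by simpa [ite_smul, Finset.sum_ite_mem] using hc) (by simpa [hi] using hne)
    (fun j hj => Or.inl ?_)).1 hi
  by_contra hjN
  simp [hjN] at hj

/-- A finite-dimensional subspace is its own double orthogonal complement. -/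
theorem exists_inner_ne_zero {N : Finset (Fin n)} {i : Fin n}
    (hi : A.normal i ∉ Submodule.span ℝ (A.normal '' (N : Set (Fin n)))) :
    ∃ x : EuclideanSpace ℝ (Fin ℓ), (∀ j ∈ N, inner ℝ (A.normal j) x = 0) ∧
      inner ℝ (A.normal i) x ≠ 0 := by
  rw [← Submodule.orthogonal_orthogonal (Submodule.span ℝ (A.normal '' (N : Set (Fin n)))),
    Submodule.mem_orthogonal'] at hi
  push Not at hi
  obtain ⟨x, hx, hne⟩ := hi
  rw [Submodule.mem_orthogonal] at hx
  exact ⟨x, fun j hj => hx _ (Submodule.subset_span ⟨j, hj, rfl⟩), hne⟩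

/-- Dual vectors of a linearly independent family of normals. -/
theorem exists_dual_vectors {N : Finset (Fin n)}
    (hN : LinearIndepOn ℝ A.normal (N : Set (Fin n))) :
    ∃ u : Fin n → EuclideanSpace ℝ (Fin ℓ), ∀ i ∈ N, ∀ k ∈ N,
      inner ℝ (A.normal i) (u k) = if i = k then (1 : ℝ) else 0 := by
  have h : ∀ k ∈ N, ∃ u : EuclideanSpace ℝ (Fin ℓ), ∀ i ∈ N,
      inner ℝ (A.normal i) u = if i = k then (1 : ℝ) else 0 := by
    intro k hk
    have hnot : A.normal k ∉ Submodule.span ℝ (A.normal '' (N.erase k : Finset (Fin n))) := by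
      rw [Finset.coe_erase]
      exact hN.notMem_span hk
    obtain ⟨x, hx, hne⟩ := A.exists_inner_ne_zero hnot
    refine ⟨(inner ℝ (A.normal k) x)⁻¹ • x, fun i hi => ?_⟩
    rw [inner_smul_right]
    split_ifs with hik
    · rw [hik, inv_mul_cancel₀ hne]
    · rw [hx i (Finset.mem_erase.2 ⟨hik, hi⟩), mul_zero]
  choose! u hu using h
  exact ⟨u, fun i hi k hk => hu k hk i hi⟩

open Polynomial in
/-- Near zero on the right, a real polynomial has the sign of its lowest coefficient. -/
theorem _root_.Polynomial.eventually_pos_coeff_mul_eval {q : ℝ[X]} {d : ℕ}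
    (h : ∀ j < d, q.coeff j = 0) (hd : q.coeff d ≠ 0) :
    ∀ᶠ t in nhdsWithin (0 : ℝ) (Set.Ioi 0), 0 < q.coeff d * q.eval t := by
  obtain ⟨r, rfl⟩ := X_pow_dvd_iff.2 h
  rw [show d = 0 + d from (zero_add d).symm, zero_add, ← zero_add d] at hd
  have hr : (Polynomial.X ^ d * r).coeff d = r.coeff 0 := by
    simpa using coeff_X_pow_mul r d 0
  have hr0 : r.coeff 0 ≠ 0 := by rw [← hr]; simpa using hd
  rw [hr]
  have hcont : ContinuousAt (fun t => r.coeff 0 * r.eval t) 0 := by fun_prop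
  have hpos : 0 < r.coeff 0 * r.eval 0 := by
    rw [← coeff_zero_eq_eval_zero]; exact mul_self_pos.2 hr0
  filter_upwards [nhdsWithin_le_nhds (hcont.eventually (lt_mem_nhds hpos)), self_mem_nhdsWithin]
    with t ht ht0
  have ht0' : (0 : ℝ) < t := ht0
  rw [eval_mul, eval_pow, eval_X, mul_left_comm]
  positivity

open Polynomial in
/-- Around a generic point of the flat of an NBC set there is a system of chambers, indexed by the
subsets of the NBC set, on which each Heaviside function depends on at most one sign. -/
theorem exists_chamber_system {m : MonomialOrder (Fin n)} {W N : Finset (Fin n)}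
    (hN : N ∈ A.nbc m W) :
    ∃ (ch : Finset (Fin n) → A.coneChambers W) (lev : Fin n → Fin n),
      (∀ i, varRank m (lev i) ≤ varRank m i) ∧
      (∀ i S T, (lev i ∈ S ↔ lev i ∈ T) → A.heaviside W i (ch S) = A.heaviside W i (ch T)) ∧
      ∀ i ∈ N, ∀ S, A.heaviside W i (ch S) = if i ∈ S then 1 else 0 := by
  classical
  obtain ⟨hnb, p, hpW, hp⟩ := A.mem_nbc.1 hN
  have hli := A.linearIndepOn_of_nbc hnb
  obtain ⟨u, hu⟩ := A.exists_dual_vectors hli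
  set U : Submodule ℝ (EuclideanSpace ℝ (Fin ℓ)) := ⨅ i ∈ N, A.hyperplane i with hU
  -- a generic direction of the flat
  obtain ⟨w, hwU, hw⟩ : ∃ w ∈ U, ∀ i, inner ℝ (A.normal i) w = 0 →
      A.normal i ∈ Submodule.span ℝ (A.normal '' N) := by
    obtain ⟨w, hwU, hw⟩ := Module.Dual.exists_forall_mem_ne_zero_of_forall_exists U
      (fun i : {i // A.normal i ∉ Submodule.span ℝ (A.normal '' (N : Set (Fin n)))} =>
        (innerₛₗ ℝ (A.normal i.1) : Module.Dual ℝ (EuclideanSpace ℝ (Fin ℓ)))) (by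
        rintro ⟨i, hi⟩
        obtain ⟨x, hx, hne⟩ := A.exists_inner_ne_zero hi
        exact ⟨x, A.mem_iInf_hyperplane.2 hx, hne⟩)
    exact ⟨w, hwU, fun i hi => by_contra fun h => hw ⟨i, h⟩ hi⟩
  rw [hU, mem_iInf_hyperplane] at hwU
  -- the coordinates of the perturbed points
  let ε : Finset (Fin n) → Fin n → ℝ := fun S k => if k ∈ S then 1 else -1
  have hε : ∀ S k, ε S k ≠ 0 := fun S k => by by_cases h : k ∈ S <;> simp [ε, h]
  -- This is the i-th normal evaluated along the curve `pt S`. The point p acts at order 0 and w at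
  -- order 1, so the exponents rank + 1 ≥ 2 come later, with smaller elements of N dominating larger
  -- ones.
  let q : Finset (Fin n) → Fin n → ℝ[X] := fun S i =>
    Polynomial.C (inner ℝ (A.normal i) p) + Polynomial.C (inner ℝ (A.normal i) w) * Polynomial.X +
      ∑ k ∈ N, Polynomial.C (ε S k * inner ℝ (A.normal i) (u k)) *
        Polynomial.X ^ (varRank m k + 1)
  let pt : Finset (Fin n) → ℝ → EuclideanSpace ℝ (Fin ℓ) := fun S t =>
    p + t • w + ∑ k ∈ N, (t ^ (varRank m k + 1) * ε S k) • u k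
  have heval : ∀ S i t, (q S i).eval t = inner ℝ (A.normal i) (pt S t) := by
    intro S i t
    simp only [q, pt, eval_add, eval_mul, eval_C, eval_X, eval_finsetSum, eval_pow,
      inner_add_right, inner_smul_right, inner_sum]
    congr 1
    · ring
    · exact Finset.sum_congr rfl fun k _ => by ring
  have hcoeff : ∀ S i d, (q S i).coeff d = (if d = 0 then inner ℝ (A.normal i) p else 0) +
      (if d = 1 then inner ℝ (A.normal i) w else 0) +
      ∑ k ∈ N, if d = varRank m k + 1 then ε S k * inner ℝ (A.normal i) (u k) else 0 := by
    intro S i d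
    simp only [q, coeff_add, coeff_C, coeff_C_mul, coeff_X, finsetSum_coeff, coeff_X_pow, mul_ite,
      mul_one, mul_zero, eq_comm (a := 1)]
  have hc0 : ∀ S i, (q S i).coeff 0 = inner ℝ (A.normal i) p := by
    intro S i
    rw [hcoeff, Finset.sum_eq_zero fun k _ => if_neg (Nat.succ_ne_zero _).symm]
    simp
  have hc1 : ∀ S i, (q S i).coeff 1 = inner ℝ (A.normal i) w := by
    intro S i
    rw [hcoeff, Finset.sum_eq_zero fun k _ => if_neg (by have := varRank_pos m k; omega)]
    simp
  have hck : ∀ S i, ∀ k ∈ N,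
      (q S i).coeff (varRank m k + 1) = ε S k * inner ℝ (A.normal i) (u k) := by
    intro S i k hk
    have := (varRank_pos m k).ne'
    rw [hcoeff, Finset.sum_eq_single k]
    · simp [this]
    · exact fun j _ hj => if_neg fun h => hj (varRank_injective m (Nat.succ_injective h)).symm
    · exact fun h => absurd hk h
  have hcz : ∀ S i d, d ≠ 0 → d ≠ 1 →
      (∀ k ∈ N, d = varRank m k + 1 → inner ℝ (A.normal i) (u k) = 0) → (q S i).coeff d = 0 := by
    intro S i d hd0 hd1 hd
    rw [hcoeff, if_neg hd0, if_neg hd1, Finset.sum_eq_zero fun k hk => ?_, add_zero, add_zero]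
    split_ifs with h
    · rw [hd k hk h, mul_zero]
    · rfl
  -- the sign of each coordinate is determined by one of the signs
  have hsign : ∀ i, ∃ lev : Fin n, varRank m lev ≤ varRank m i ∧
      ∀ S, ∃ d, (∀ j < d, (q S i).coeff j = 0) ∧
        (q S i).coeff d ≠ 0 ∧ (i ∈ N → (q S i).coeff d = ε S i) ∧
        ∀ T, (lev ∈ S ↔ lev ∈ T) →
          (∀ j < d, (q T i).coeff j = 0) ∧ (q T i).coeff d = (q S i).coeff d := by
    intro i
    by_cases hip : inner ℝ (A.normal i) p = 0
    swap
    -- When p or, in the next case, w decides the sign, it does not depend on S. Any index of rank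
    -- at most that of i would do as `lev`.
    · refine ⟨i, le_rfl, fun S => ⟨0, by simp, by rwa [hc0], fun hi => absurd (hp i hi) hip,
        fun T _ => ?_⟩⟩
      exact ⟨by simp, by rw [hc0, hc0]⟩
    by_cases hiw : inner ℝ (A.normal i) w = 0
    swap
    · refine ⟨i, le_rfl, fun S => ⟨1, ?_, by rwa [hc1], fun hi => absurd (hwU i hi) hiw,
        fun T _ => ?_⟩⟩
      · intro j hj
        rw [Nat.lt_one_iff.1 hj, hc0, hip]
      · refine ⟨fun j hj => ?_, by rw [hc1, hc1]⟩
        rw [Nat.lt_one_iff.1 hj, hc0, hip]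
    obtain ⟨c, hc⟩ := Submodule.mem_span_image_finset_iff_exists_fun' ℝ |>.1 (hw i hiw)
    have hcu : ∀ k ∈ N, inner ℝ (A.normal i) (u k) = c k := by
      intro k hk
      rw [← hc, sum_inner, Finset.sum_eq_single k]
      · simp [inner_smul_left, hu k hk k hk]
      · intro j hj hjk
        simp [inner_smul_left, hu j hj k hk, hjk]
      · exact fun h => absurd hk h
    have hex : ∃ k ∈ N, c k ≠ 0 := by
      by_contra hno
      push Not at hno
      refine A.normal_ne_zero i ?_
      rw [← hc]
      exact Finset.sum_eq_zero fun k hk => by rw [hno k hk, zero_smul]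
    -- The normal of i is now a combination of those of N with coefficients c. The lowest surviving
    -- power of t comes from the least k with c k ≠ 0, so only the sign chosen at k matters.
    obtain ⟨k, hk, hkmin⟩ := Finset.exists_min_image (N.filter fun k => c k ≠ 0) (varRank m)
      (hex.imp fun k hk => Finset.mem_filter.2 hk)
    rw [Finset.mem_filter] at hk
    have hlow : ∀ T, ∀ j < varRank m k + 1, (q T i).coeff j = 0 := by
      intro T j hj
      by_cases hj0 : j = 0
      · rw [hj0, hc0, hip]
      by_cases hj1 : j = 1
      · rw [hj1, hc1, hiw]
      refine hcz T i j hj0 hj1 fun k' hk' hjk => ?_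
      rw [hcu k' hk']
      by_contra hne
      have := hkmin k' (Finset.mem_filter.2 ⟨hk', hne⟩)
      omega
    have hikN : i ∈ N → k = i := by
      intro hi
      have := hcu k hk.1
      rw [hu i hi k hk.1] at this
      by_contra hne
      rw [if_neg (Ne.symm hne)] at this
      exact hk.2 this.symm
    refine ⟨k, ?_, fun S => ⟨varRank m k + 1, hlow S, ?_, ?_, fun T hT => ⟨hlow T, ?_⟩⟩⟩
    · by_cases hi : i ∈ N
      · rw [hikN hi]
      -- The relation expressing the normal of i through N has an element of N smaller than i,
      -- because N contains no broken circuit.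
      · obtain ⟨-, k', hk'N, hk', hlt⟩ := A.exists_rank_lt_of_dependency hnb
          (c := fun j => (if j ∈ N then c j else 0) - if j = i then 1 else 0) (i₀ := i)
          (by simp [sub_smul, ite_smul, Finset.sum_sub_distrib, Finset.sum_ite_mem, hc])
          (by simp [hi]) (fun j hj => by
            by_contra hno
            rw [not_or] at hno
            simp [hno.1, hno.2] at hj)
        have hne : k' ≠ i := fun h => hi (h ▸ hk'N)
        simp only [hk'N, if_true, hne, if_false, sub_zero] at hk'
        exact (hkmin k' (Finset.mem_filter.2 ⟨hk'N, hk'⟩)).trans hlt.le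
    · rw [hck S i k hk.1, hcu k hk.1]
      exact mul_ne_zero (hε S k) hk.2
    · intro hi
      have hki := hikN hi
      subst hki
      rw [hck S k k hi, hu k hi k hi, if_pos rfl, mul_one]
    · rw [hck S i k hk.1, hck T i k hk.1]
      simp only [ε, hT]
  choose lev hlev d hlow hne hself hdep using hsign
  have hev : ∀ᶠ t in nhdsWithin (0 : ℝ) (Set.Ioi 0), ∀ S i,
      0 < (q S i).coeff (d i S) * inner ℝ (A.normal i) (pt S t) := by
    refine Filter.eventually_all.2 fun S => Filter.eventually_all.2 fun i => ?_
    simpa only [heval] using Polynomial.eventually_pos_coeff_mul_eval (hlow i S) (hne i S)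
  obtain ⟨t, ht⟩ := hev.exists
  have hiff : ∀ S i, 0 < inner ℝ (A.normal i) (pt S t) ↔ 0 < (q S i).coeff (d i S) := by
    intro S i
    exact (pos_iff_pos_of_mul_pos (ht S i)).symm
  have hcomp : ∀ S, pt S t ∈ A.complement := fun S => A.mem_complement.2 fun i h => by
    have := ht S i
    rw [h, mul_zero] at this
    exact lt_irrefl _ this
  have hcone : ∀ S, pt S t ∈ A.cone W := by
    intro S
    refine A.mem_cone.2 fun i hi => (hiff S i).2 ?_
    have hpos := A.mem_cone.1 hpW i hi
    -- On a wall the constant coefficient is already positive at p, so the perturbation stays in the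
    -- cone.
    have hd : d i S = 0 := by
      by_contra hd
      have := hlow i S 0 (Nat.pos_of_ne_zero hd)
      rw [hc0] at this
      exact hpos.ne' this
    rw [hd, hc0]
    exact hpos
  refine ⟨fun S => chamberAt (hcomp S) (hcone S), lev, hlev, fun i S T hST => ?_, fun i hi S => ?_⟩
  · rw [heaviside_chamberAt, heaviside_chamberAt]
    refine if_congr ?_ rfl rfl
    rw [hiff, hiff]
    obtain ⟨hlowT, heq⟩ := hdep i S T hST
    -- Both are the index of the first nonzero coefficient, and the two polynomials agree up to
    -- there.
    have hdd : d i T = d i S := by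
      refine le_antisymm (not_lt.1 fun hlt => ?_) (not_lt.1 fun hlt => ?_)
      · exact hne i S (heq ▸ hlow i T _ hlt)
      · exact hne i T (hlowT _ hlt)
    rw [hdd, heq]
  · rw [heaviside_chamberAt]
    refine if_congr ?_ rfl rfl
    rw [hiff, hself i S hi]
    by_cases h : i ∈ S <;> simp [ε, h]

/-- The product of the Heaviside functions of a set of hyperplanes. -/
noncomputable def heavisideProd (W N : Finset (Fin n)) : A.VG W := ∏ i ∈ N, A.heaviside W i

/-- For each NBC set there is a functional that detects it among the sets of at most the same
weight, the weight being the sum of the ranks. -/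
theorem exists_detecting_functional {m : MonomialOrder (Fin n)} {W N : Finset (Fin n)}
    (hN : N ∈ A.nbc m W) :
    ∃ L : A.VG W →ₗ[ℤ] ℤ, L (A.heavisideProd W N) ≠ 0 ∧ ∀ M : Finset (Fin n),
      L (A.heavisideProd W M) ≠ 0 → ∑ i ∈ M, varRank m i ≤ ∑ i ∈ N, varRank m i → M = N := by
  classical
  obtain ⟨ch, lev, hlev, hdep, hself⟩ := A.exists_chamber_system hN
  -- Up to sign this is the mixed difference over all coordinates in N. It kills every function that
  -- ignores one of them.
  let L : A.VG W →ₗ[ℤ] ℤ := ∑ S ∈ N.powerset, (-1 : ℤ) ^ S.card • LinearMap.proj (ch S)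
  have hL : ∀ f, L f = ∑ S ∈ N.powerset, (-1 : ℤ) ^ S.card * f (ch S) := fun f => by
    simp [L, LinearMap.sum_apply]
  refine ⟨L, ?_, fun M hM hle => ?_⟩
  · rw [hL, Finset.sum_eq_single N]
    · rw [heavisideProd, Finset.prod_apply,
        Finset.prod_eq_one fun i hi => by rw [hself i hi, if_pos hi]]
      simp
    · intro S hS hSN
      obtain ⟨i, hi, hiS⟩ := Finset.not_subset.1 fun h =>
        hSN ((Finset.mem_powerset.1 hS).antisymm h)
      rw [heavisideProd, Finset.prod_apply,
        Finset.prod_eq_zero hi (by rw [hself i hi, if_neg hiS]), mul_zero]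
    · exact fun h => absurd (Finset.mem_powerset_self N) h
  -- If k in N is not a level of any member of M, the product over M does not depend on the sign at
  -- k, and the terms for S and S ∪ {k} cancel.
  · have hsub : N ⊆ M.image lev := by
      intro k hk
      by_contra hkM
      refine hM ?_
      rw [hL, ← Finset.insert_erase hk, Finset.sum_powerset_insert (Finset.notMem_erase k N),
        ← Finset.sum_add_distrib]
      refine Finset.sum_eq_zero fun S hS => ?_
      have hkS : k ∉ S := fun h => Finset.notMem_erase k N (Finset.mem_powerset.1 hS h)
      have heq : A.heavisideProd W M (ch (insert k S)) = A.heavisideProd W M (ch S) := by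
        rw [heavisideProd, Finset.prod_apply, Finset.prod_apply]
        refine Finset.prod_congr rfl fun i hi => hdep i _ _ ?_
        have : lev i ≠ k := fun h => hkM (h ▸ Finset.mem_image_of_mem lev hi)
        simp [this]
      rw [heq, Finset.card_insert_of_notMem hkS, pow_succ]
      ring
    -- With the weight hypothesis these inequalities close into equalities. Hence `lev` is the
    -- identity on M, so N ⊆ M, and equal weights force N = M.
    have h1 : ∑ i ∈ N, varRank m i ≤ ∑ i ∈ M.image lev, varRank m i :=
      Finset.sum_le_sum_of_subset hsub
    have h2 : ∑ i ∈ M.image lev, varRank m i ≤ ∑ i ∈ M, varRank m (lev i) :=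
      Finset.sum_image_le_of_nonneg fun _ _ => Nat.zero_le _
    have h3 : ∑ i ∈ M, varRank m (lev i) ≤ ∑ i ∈ M, varRank m i :=
      Finset.sum_le_sum fun i _ => hlev i
    have h4 : ∀ i ∈ M, lev i = i := fun i hi => varRank_injective m
      ((Finset.sum_eq_sum_iff_of_le fun i _ => hlev i).1
        (h3.antisymm (hle.trans (h1.trans h2))) i hi)
    have himg : M.image lev = M := by
      rw [Finset.image_congr fun i hi => h4 i hi, Finset.image_id']
    rw [himg] at hsub
    refine (hsub.antisymm fun i hi => ?_).symm
    by_contra hiN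
    have := Finset.sum_lt_sum_of_subset hsub hi hiN (varRank_pos m i) fun _ _ _ => Nat.zero_le _
    exact this.not_ge hle

/-- Triangularity: in a relation, the functional of a set of largest weight with nonzero coefficient
sees only that set. -/
theorem linearIndependent_heavisideProd (m : MonomialOrder (Fin n)) (W : Finset (Fin n)) :
    LinearIndependent ℤ fun N : A.nbc m W => A.heavisideProd W N.1 := by
  rw [Fintype.linearIndependent_iff]
  intro c hc
  by_contra hne
  push Not at hne
  obtain ⟨N₀, hN₀⟩ := hne
  obtain ⟨N, hN, hmax⟩ := Finset.exists_max_image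
    (Finset.univ.filter fun N : A.nbc m W => c N ≠ 0) (fun N => ∑ i ∈ N.1, varRank m i)
    ⟨N₀, by simpa using hN₀⟩
  rw [Finset.mem_filter] at hN
  obtain ⟨L, hL, hLM⟩ := A.exists_detecting_functional N.2
  have h0 := congrArg L hc
  rw [map_sum, map_zero, Finset.sum_eq_single N] at h0
  · rw [map_smul, smul_eq_mul] at h0
    exact (mul_ne_zero hN.2 hL) h0
  · intro M _ hMN
    rw [map_smul, smul_eq_mul]
    by_cases hcM : c M = 0
    · rw [hcM, zero_mul]
    · by_contra h
      refine hMN (Subtype.ext (hLM M.1 (right_ne_zero_of_mul h) (hmax M ?_)))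
      exact Finset.mem_filter.2 ⟨Finset.mem_univ _, hcM⟩
  · exact fun h => absurd (Finset.mem_univ N) h

end CentralArrangement

/-! ### Presentations from spanning and independence -/

section Presentation

/-- A ring map is an isomorphism modulo `I` with prescribed basis as soon as it kills `I`, is
surjective, and a family that spans modulo `I` has linearly independent images. -/
theorem exists_quotient_ringEquiv_basis {ι R S : Type*} [Fintype ι] [CommRing R] [CommRing S]
    (I : Ideal R) (φ : R →+* S) (hI : ∀ x ∈ I, φ x = 0) (hφ : Function.Surjective φ) (g : ι → R)
    (hspan : ∀ x, ∃ c : ι → ℤ, x - ∑ i, c i • g i ∈ I)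
    (hli : LinearIndependent ℤ fun i => φ (g i)) :
    ∃ Φ : (R ⧸ I) ≃+* S, (∀ x, Φ (Ideal.Quotient.mk I x) = φ x) ∧
      ∃ b : Module.Basis ι ℤ S, ∀ i, b i = Φ (Ideal.Quotient.mk I (g i)) := by
  have hinj : Function.Injective (Ideal.Quotient.lift I φ hI) := by
    rw [injective_iff_map_eq_zero]
    intro y hy
    obtain ⟨x, rfl⟩ := Ideal.Quotient.mk_surjective y
    rw [Ideal.Quotient.lift_mk] at hy
    obtain ⟨c, hc⟩ := hspan x
    have h0 := hI _ hc
    rw [map_sub, hy, zero_sub, neg_eq_zero, map_sum] at h0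
    simp only [map_zsmul] at h0
    have hc0 := Fintype.linearIndependent_iff.1 hli c h0
    simpa [hc0, Ideal.Quotient.eq_zero_iff_mem] using hc
  have hsurj : Function.Surjective (Ideal.Quotient.lift I φ hI) :=
    Ideal.Quotient.lift_surjective_of_surjective I hI hφ
  refine ⟨RingEquiv.ofBijective _ ⟨hinj, hsurj⟩, fun x => rfl, Module.Basis.mk hli ?_, fun i => ?_⟩
  · rintro s -
    obtain ⟨x, rfl⟩ := hφ s
    obtain ⟨c, hc⟩ := hspan x
    have h0 := hI _ hc
    rw [map_sub, sub_eq_zero, map_sum] at h0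
    rw [h0]
    exact sum_mem fun i _ => by
      rw [map_zsmul]
      exact zsmul_mem (Submodule.subset_span (Set.mem_range_self i)) _
  · rw [Module.Basis.mk_apply]
    rfl

end Presentation

namespace CentralArrangement

variable {ℓ n : ℕ} (A : CentralArrangement ℓ n)

/-! ### The Varchenko-Gel'fand ring and its filtration -/

theorem aeval_heaviside_sqfreeMonomial (W N : Finset (Fin n)) :
    MvPolynomial.aeval (A.heaviside W) (sqfreeMonomial N) = A.heavisideProd W N := by
  simp [sqfreeMonomial, heavisideProd]

/-- The indicator of a chamber is the product of x_i or 1 - x_i according to its signs, since signs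
determine chambers. -/
theorem aeval_heaviside_surjective (W : Finset (Fin n)) :
    Function.Surjective (MvPolynomial.aeval (R := ℤ) (A.heaviside W)) := by
  classical
  have := Fintype.ofFinite (A.coneChambers W)
  intro f
  let e : A.coneChambers W → MvPolynomial (Fin n) ℤ := fun C =>
    ∏ i, if A.heaviside W i C = 1 then MvPolynomial.X i else 1 - MvPolynomial.X i
  have he : ∀ C D, MvPolynomial.aeval (A.heaviside W) (e C) D = if C = D then 1 else 0 := by
    intro C D
    simp only [e, map_prod, Finset.prod_apply, apply_ite (MvPolynomial.aeval (A.heaviside W)),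
      map_sub, map_one, MvPolynomial.aeval_X]
    split_ifs with h
    · subst h
      refine Finset.prod_eq_one fun i _ => ?_
      rcases A.heaviside_eq_zero_or_one C i with hi | hi <;> simp [hi]
    · by_contra hne
      rw [Finset.prod_eq_zero_iff] at hne
      push Not at hne
      refine h (A.coneChambers_ext fun i => ?_)
      have := hne i (Finset.mem_univ i)
      rcases A.heaviside_eq_zero_or_one C i with hi | hi <;>
        rcases A.heaviside_eq_zero_or_one D i with hj | hj <;> simp_all
  refine ⟨∑ C, MvPolynomial.C (f C) * e C, ?_⟩
  funext D
  simp [Finset.sum_apply, he]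

theorem aeval_heaviside_of_mem_span {W : Finset (Fin n)} {x : MvPolynomial (Fin n) ℤ}
    (hx : x ∈ Ideal.span (A.relations W)) : MvPolynomial.aeval (A.heaviside W) x = 0 := by
  have : Ideal.span (A.relations W) ≤ RingHom.ker (MvPolynomial.aeval (R := ℤ) (A.heaviside W)) :=
    Ideal.span_le.2 fun g hg => A.aeval_heaviside_eq_zero hg
  exact this hx

theorem exists_sub_sum_sqfreeMonomial_mem {m : MonomialOrder (Fin n)} (hm : RefinesDegree m)
    {W : Finset (Fin n)} {I : Ideal (MvPolynomial (Fin n) ℤ)}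
    (hI : I = Ideal.span (inDeg '' A.relations W) ∨ I = Ideal.span (A.relations W))
    (x : MvPolynomial (Fin n) ℤ) :
    ∃ c : A.nbc m W → ℤ, x - ∑ N, c N • sqfreeMonomial N.1 ∈ I := by
  have hx : x ∈ I.restrictScalars ℤ ⊔
      Submodule.span ℤ (Set.range fun N : A.nbc m W => sqfreeMonomial N.1) := by
    have hx : x ∈ MvPolynomial.restrictSupport ℤ (Set.univ : Set (Fin n →₀ ℕ)) := by
      rw [MvPolynomial.restrictSupport_univ]; trivial
    rw [MvPolynomial.restrictSupport_eq_span] at hx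
    refine Submodule.span_le.2 ?_ hx
    rintro _ ⟨a, -, rfl⟩
    have hsub : sqfreeMonomial '' {N | N ∈ A.nbc m W ∧ N.card ≤ a.degree} ⊆
        Set.range fun N : A.nbc m W => sqfreeMonomial N.1 := by
      rintro _ ⟨N, hN, rfl⟩
      exact ⟨⟨N, hN.1⟩, rfl⟩
    have hle := Submodule.span_mono (R := ℤ) hsub
    exact sup_le_sup_left hle _ (A.monomial_mem_sup_nbc hm hI a)
  obtain ⟨y, hy, z, hz, rfl⟩ := Submodule.mem_sup.1 hx
  obtain ⟨c, rfl⟩ := (Submodule.mem_span_range_iff_exists_fun ℤ).1 hz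
  exact ⟨c, by simpa using hy⟩

/-- The filtration in terms of NBC sets. -/
theorem degreeFiltration_eq_span {m : MonomialOrder (Fin n)} (hm : RefinesDegree m)
    (W : Finset (Fin n)) (d : ℕ) : (A.degreeFiltration W).F d =
      Submodule.span ℤ (A.heavisideProd W '' {N | N ∈ A.nbc m W ∧ N.card ≤ d}) := by
  refine le_antisymm (Submodule.span_le.2 ?_) (Submodule.span_le.2 ?_)
  · rintro _ ⟨a, ha, rfl⟩
    obtain ⟨y, hy, z, hz, hyz⟩ := Submodule.mem_sup.1
      (A.monomial_mem_sup_nbc hm (W := W) (Or.inr rfl) (Finsupp.equivFunOnFinite.symm a))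
    have hdeg : (Finsupp.equivFunOnFinite.symm a).degree = ∑ i, a i := by
      simp [Finsupp.degree_eq_sum]
    have hmon : MvPolynomial.aeval (A.heaviside W)
        (MvPolynomial.monomial (Finsupp.equivFunOnFinite.symm a) (1 : ℤ))
          = ∏ i, A.heaviside W i ^ a i := by
      rw [MvPolynomial.aeval_monomial, map_one, one_mul,
        Finsupp.prod_fintype _ _ fun i => pow_zero _]
      rfl
    rw [SetLike.mem_coe, ← hmon, ← hyz, map_add, A.aeval_heaviside_of_mem_span hy, zero_add]
    clear hyz
    induction hz using Submodule.span_induction with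
    | mem x hx =>
      obtain ⟨N, hN, rfl⟩ := hx
      rw [aeval_heaviside_sqfreeMonomial]
      exact Submodule.subset_span ⟨N, ⟨hN.1, hN.2.trans (hdeg.trans_le ha)⟩, rfl⟩
    | zero => rw [map_zero]; exact zero_mem _
    | add x y _ _ hx hy => rw [map_add]; exact add_mem hx hy
    | smul c x _ hx => rw [map_smul]; exact Submodule.smul_mem _ c hx
  · rintro _ ⟨N, hN, rfl⟩
    refine Submodule.subset_span ⟨fun i => if i ∈ N then 1 else 0, by simpa using hN.2, ?_⟩
    simp [heavisideProd, pow_ite, Finset.prod_ite_mem]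

end CentralArrangement

/-! ### The associated graded ring of a filtration with an adapted basis -/

namespace RingFiltration

variable {R : Type*} [CommRing R] (𝓕 : RingFiltration R)

theorem toPiece_eq_zero_iff {d : ℕ} {f : R} (hf : f ∈ 𝓕.F d) :
    𝓕.toPiece d f hf = 0 ↔ f ∈ 𝓕.prev d := by
  rw [toPiece, Submodule.Quotient.mk_eq_zero]
  rfl

variable {ι : Type*} {v : ι → R} {deg : ι → ℕ}

theorem prev_eq_span (hF : ∀ d, 𝓕.F d = Submodule.span ℤ (v '' {i | deg i ≤ d})) (d : ℕ) :
    𝓕.prev d = Submodule.span ℤ (v '' {i | deg i < d}) := by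
  cases d with
  | zero => simp [prev]
  | succ d => simp only [prev, hF, Nat.lt_succ_iff]

theorem mem_of_basis (hF : ∀ d, 𝓕.F d = Submodule.span ℤ (v '' {i | deg i ≤ d})) {i : ι} {d : ℕ}
    (h : deg i = d) : v i ∈ 𝓕.F d := by
  rw [hF]
  exact Submodule.subset_span ⟨i, h.le, rfl⟩

/-- A combination of degree-d vectors that lies in the span of lower ones is trivial by
independence; conversely, the lower basis vectors die in the quotient. -/
theorem exists_basis_piece (hv : LinearIndependent ℤ v)
    (hF : ∀ d, 𝓕.F d = Submodule.span ℤ (v '' {i | deg i ≤ d})) (d : ℕ) :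
    ∃ b : Module.Basis {i // deg i = d} ℤ (𝓕.Piece d),
      ∀ i, b i = 𝓕.toPiece d (v i.1) (𝓕.mem_of_basis hF i.2) := by
  have hli : LinearIndependent ℤ
      fun i : {i // deg i = d} => 𝓕.toPiece d (v i.1) (𝓕.mem_of_basis hF i.2) := by
    rw [linearIndependent_iff']
    intro s c hc i hi
    have hsum : ∑ j ∈ s, c j • v j.1 ∈ 𝓕.prev d := by
      have hmem : ∑ j ∈ s, c j • v j.1 ∈ 𝓕.F d :=
        sum_mem fun j _ => Submodule.smul_mem _ _ (𝓕.mem_of_basis hF j.2)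
      rw [← 𝓕.toPiece_eq_zero_iff hmem, ← hc]
      have hmk : ∀ j : {i // deg i = d}, 𝓕.toPiece d (v j.1) (𝓕.mem_of_basis hF j.2)
          = Submodule.mkQ ((𝓕.prev d).submoduleOf (𝓕.F d)) ⟨v j.1, 𝓕.mem_of_basis hF j.2⟩ :=
        fun _ => rfl
      simp only [hmk, ← map_smul, ← map_sum]
      rw [toPiece, Submodule.mkQ_apply]
      congr 1
      exact Subtype.ext (by simp)
    rw [prev_eq_span 𝓕 hF] at hsum
    have hsum' : ∑ j ∈ s, c j • v j.1 ∈ Submodule.span ℤ (v '' {i | deg i = d}) :=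
      sum_mem fun j _ => Submodule.smul_mem _ _ (Submodule.subset_span ⟨j.1, j.2, rfl⟩)
    have hdisj : Disjoint {i | deg i < d} {i | deg i = d} :=
      Set.disjoint_left.2 fun i h1 h2 => (ne_of_lt h1) h2
    have h0 := Submodule.disjoint_def.1 (hv.disjoint_span_image hdisj) _ hsum hsum'
    exact linearIndependent_iff'.1 (hv.comp _ Subtype.val_injective) s c h0 i hi
  refine ⟨Module.Basis.mk hli ?_, fun i => Module.Basis.mk_apply _ _ _⟩
  rintro x -
  obtain ⟨⟨f, hf⟩, rfl⟩ := Submodule.Quotient.mk_surjective _ x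
  -- The membership proof inside `toPiece` is quantified so that the induction can vary f.
  suffices h : ∀ f ∈ Submodule.span ℤ (v '' {i | deg i ≤ d}), ∀ hf : f ∈ 𝓕.F d,
      𝓕.toPiece d f hf ∈ Submodule.span ℤ (Set.range fun i : {i // deg i = d} =>
        𝓕.toPiece d (v i.1) (𝓕.mem_of_basis hF i.2)) from h f (hF d ▸ hf) hf
  intro f hf
  induction hf using Submodule.span_induction with
  | mem x hx =>
    obtain ⟨i, hi, rfl⟩ := hx
    intro hf
    rcases (show deg i ≤ d from hi).eq_or_lt with h | h
    · exact Submodule.subset_span ⟨⟨i, h⟩, rfl⟩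
    · rw [(𝓕.toPiece_eq_zero_iff hf).2]
      · exact zero_mem _
      · rw [prev_eq_span 𝓕 hF]
        exact Submodule.subset_span ⟨i, h, rfl⟩
  | zero => intro _; exact zero_mem _
  | add x y hx hy ihx ihy =>
    intro _
    rw [← hF] at hx hy
    exact add_mem (ihx hx) (ihy hy)
  | smul c x hx ih =>
    intro _
    rw [← hF] at hx
    exact Submodule.smul_mem _ c (ih hx)

/-- The bases of the pieces are indexed by the fibres of `deg`, and these fibres partition the index
set. -/
theorem exists_basis_gr (hv : LinearIndependent ℤ v)
    (hF : ∀ d, 𝓕.F d = Submodule.span ℤ (v '' {i | deg i ≤ d})) :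
    ∃ b : Module.Basis ι ℤ 𝓕.Gr,
      ∀ i, b i = 𝓕.toGr (deg i) (v i) (𝓕.mem_of_basis hF rfl) := by
  choose b hb using 𝓕.exists_basis_piece hv hF
  let B := (DFinsupp.basis b).reindex (Equiv.sigmaFiberEquiv deg)
  have h : ∀ i, B i = DFinsupp.single (deg i) (b (deg i) ⟨i, rfl⟩) := by
    intro i
    have h1 : B i = DFinsupp.basis b ⟨deg i, ⟨i, rfl⟩⟩ := Module.Basis.reindex_apply _ _ _
    rw [h1, Module.Basis.apply_eq_iff]
    simp [DFinsupp.basis, Equiv.symm_apply_eq, sigmaFinsuppEquivDFinsupp_single]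
  refine ⟨B, fun i => (h i).trans ?_⟩
  rw [hb]
  rfl

end RingFiltration

/-! ### Symbols in the associated graded ring -/

namespace RingFiltration

variable {R : Type*} [CommRing R] (𝓕 : RingFiltration R)

/-- `y` is the class in degree `d` of `f ∈ F d`. -/
def IsSymbol (d : ℕ) (f : R) (y : 𝓕.Gr) : Prop := ∃ h : f ∈ 𝓕.F d, y = 𝓕.toGr d f h

variable {𝓕}

/-- Products in the graded ring are computed on representatives. The relational form lets degrees be
rewritten without transport between pieces. -/
theorem IsSymbol.mul {c d : ℕ} {f g : R} {y z : 𝓕.Gr} (hf : 𝓕.IsSymbol c f y)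
    (hg : 𝓕.IsSymbol d g z) : 𝓕.IsSymbol (c + d) (f * g) (y * z) := by
  obtain ⟨hf, rfl⟩ := hf
  obtain ⟨hg, rfl⟩ := hg
  exact ⟨𝓕.mul_mem hf hg, DirectSum.of_mul_of (A := 𝓕.Piece) _ _⟩

theorem isSymbol_one : 𝓕.IsSymbol 0 1 1 := ⟨𝓕.one_mem, rfl⟩

theorem isSymbol_zero (d : ℕ) : 𝓕.IsSymbol d 0 0 :=
  ⟨zero_mem _, (map_zero (DirectSum.of 𝓕.Piece d)).symm⟩

theorem IsSymbol.add {d : ℕ} {f g : R} {y z : 𝓕.Gr} (hf : 𝓕.IsSymbol d f y)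
    (hg : 𝓕.IsSymbol d g z) : 𝓕.IsSymbol d (f + g) (y + z) := by
  obtain ⟨hf, rfl⟩ := hf
  obtain ⟨hg, rfl⟩ := hg
  exact ⟨add_mem hf hg, (map_add (DirectSum.of 𝓕.Piece d) _ _).symm⟩

theorem IsSymbol.zsmul {d : ℕ} {f : R} {y : 𝓕.Gr} (hf : 𝓕.IsSymbol d f y) (k : ℤ) :
    𝓕.IsSymbol d (k • f) (k • y) := by
  obtain ⟨hf, rfl⟩ := hf
  exact ⟨Submodule.smul_mem _ k hf, (map_zsmul (DirectSum.of 𝓕.Piece d) k _).symm⟩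

theorem IsSymbol.pow {d : ℕ} {f : R} {y : 𝓕.Gr} (hf : 𝓕.IsSymbol d f y) (k : ℕ) :
    𝓕.IsSymbol (k * d) (f ^ k) (y ^ k) := by
  induction k with
  | zero => simpa using isSymbol_one
  | succ k ih => rw [pow_succ, pow_succ, Nat.succ_mul]; exact ih.mul hf

theorem IsSymbol.prod {ι : Type*} (s : Finset ι) {d : ι → ℕ} {f : ι → R} {y : ι → 𝓕.Gr}
    (h : ∀ i ∈ s, 𝓕.IsSymbol (d i) (f i) (y i)) :
    𝓕.IsSymbol (∑ i ∈ s, d i) (∏ i ∈ s, f i) (∏ i ∈ s, y i) := by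
  classical
  induction s using Finset.induction_on with
  | empty => exact isSymbol_one
  | insert a s ha ih =>
    rw [Finset.sum_insert ha, Finset.prod_insert ha, Finset.prod_insert ha]
    exact (h a (Finset.mem_insert_self a s)).mul
      (ih fun i hi => h i (Finset.mem_insert_of_mem hi))

theorem IsSymbol.sum {ι : Type*} (s : Finset ι) {d : ℕ} {f : ι → R} {y : ι → 𝓕.Gr}
    (h : ∀ i ∈ s, 𝓕.IsSymbol d (f i) (y i)) : 𝓕.IsSymbol d (∑ i ∈ s, f i) (∑ i ∈ s, y i) := by
  classical
  induction s using Finset.induction_on with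
  | empty => exact isSymbol_zero d
  | insert a s ha ih =>
    rw [Finset.sum_insert ha, Finset.sum_insert ha]
    exact (h a (Finset.mem_insert_self a s)).add
      (ih fun i hi => h i (Finset.mem_insert_of_mem hi))

theorem IsSymbol.eq_zero {d : ℕ} {f : R} {y : 𝓕.Gr} (h : 𝓕.IsSymbol d f y)
    (hf : f ∈ 𝓕.prev d) : y = 0 := by
  obtain ⟨h, rfl⟩ := h
  rw [toGr, (𝓕.toPiece_eq_zero_iff h).2 hf]
  exact map_zero (DirectSum.of 𝓕.Piece d)

-- For a homogeneous polynomial, evaluating and passing to the graded ring commute. This links the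
-- two presentations.
open MvPolynomial in
theorem isSymbol_aeval {σ : Type*} [Fintype σ] {f : σ → R} {y : σ → 𝓕.Gr}
    (h : ∀ i, 𝓕.IsSymbol 1 (f i) (y i)) {d : ℕ} {p : MvPolynomial σ ℤ} (hp : p.IsHomogeneous d) :
    𝓕.IsSymbol d (aeval f p) (aeval y p) := by
  rw [p.as_sum, map_sum, map_sum]
  refine IsSymbol.sum _ fun a ha => ?_
  have hdeg : ∑ i, a i * 1 = d := by
    have had : a.degree = d := by
      by_contra hne
      exact mem_support_iff.1 ha (hp.coeff_eq_zero hne)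
    rw [← had]
    simp [Finsupp.degree_eq_sum]
  have hprod := (IsSymbol.prod Finset.univ fun i _ => (h i).pow (a i)).zsmul (coeff a p)
  rw [hdeg] at hprod
  convert hprod using 1
  all_goals
    rw [aeval_monomial, Finsupp.prod_fintype _ _ fun i => pow_zero _, zsmul_eq_mul]
    simp

-- Since g vanishes at f, its initial form takes the same value as minus its lower terms, which lies
-- one step down in the filtration and so has zero class.
open MvPolynomial in
theorem aeval_inDeg_eq_zero {σ : Type*} [Fintype σ] {f : σ → R} {y : σ → 𝓕.Gr}
    (h : ∀ i, 𝓕.IsSymbol 1 (f i) (y i)) {g : MvPolynomial σ ℤ} (hg : aeval f g = 0) :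
    aeval y (inDeg g) = 0 := by
  refine (isSymbol_aeval h (homogeneousComponent_isHomogeneous g.totalDegree g)).eq_zero ?_
  have hg' : aeval f (inDeg g) = - aeval f (g - inDeg g) := by rw [map_sub, hg]; ring
  change aeval f (inDeg g) ∈ _
  rw [hg', (g - inDeg g).as_sum, map_sum]
  refine neg_mem (sum_mem fun a ha => ?_)
  have hlt : a.degree < g.totalDegree := by
    rw [mem_support_iff, coeff_sub, inDeg, coeff_homogeneousComponent] at ha
    split_ifs at ha with hd
    · simp at ha
    · rw [sub_zero] at ha
      exact lt_of_le_of_ne (le_totalDegree (mem_support_iff.2 ha)) hd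
  obtain ⟨hmem, -⟩ := isSymbol_aeval h (isHomogeneous_monomial (coeff a (g - inDeg g))
    (rfl : a.degree = a.degree))
  -- A term of lower degree exists, so the top degree is positive and `prev` is a genuine filtration
  -- step instead of zero.
  obtain ⟨k, hk⟩ := Nat.exists_eq_succ_of_ne_zero (Nat.ne_zero_of_lt hlt)
  rw [hk] at hlt ⊢
  exact 𝓕.mono (Nat.lt_succ_iff.1 hlt) hmem

end RingFiltration

/-! ### The two presentations and the Hilbert series -/

namespace CentralArrangement

variable {ℓ n : ℕ} (A : CentralArrangement ℓ n)

theorem isSymbol_grHeaviside (W : Finset (Fin n)) (i : Fin n) :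
    (A.degreeFiltration W).IsSymbol 1 (A.heaviside W i) (A.grHeaviside W i) :=
  ⟨A.heaviside_mem W i, rfl⟩

theorem degreeFiltration_eq_span_nbc {m : MonomialOrder (Fin n)} (hm : RefinesDegree m)
    (W : Finset (Fin n)) (d : ℕ) : (A.degreeFiltration W).F d = Submodule.span ℤ
      ((fun N : A.nbc m W => A.heavisideProd W N.1) '' {N | N.1.card ≤ d}) := by
  rw [A.degreeFiltration_eq_span hm]
  congr 1
  ext f
  constructor
  · rintro ⟨N, ⟨hN, hd⟩, rfl⟩
    exact ⟨⟨N, hN⟩, hd, rfl⟩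
  · rintro ⟨N, hd, rfl⟩
    exact ⟨N.1, ⟨N.2, hd⟩, rfl⟩

theorem hilbertSeries_eq {m : MonomialOrder (Fin n)} (hm : RefinesDegree m)
    (W : Finset (Fin n)) : (A.degreeFiltration W).hilbertSeries
      = ∑ N ∈ A.nbc m W, (PowerSeries.X : PowerSeries ℤ) ^ N.card := by
  ext d
  obtain ⟨b, -⟩ := (A.degreeFiltration W).exists_basis_piece
    (A.linearIndependent_heavisideProd m W) (A.degreeFiltration_eq_span_nbc hm W) d
  rw [RingFiltration.hilbertSeries, PowerSeries.coeff_mk, Module.finrank_eq_nat_card_basis b,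
    map_sum]
  simp only [PowerSeries.coeff_X_pow]
  rw [← Finset.sum_coe_sort, Finset.sum_boole, Nat.card_eq_fintype_card, Fintype.card_subtype]
  simp only [eq_comm]

theorem exists_vg_presentation {m : MonomialOrder (Fin n)} (hm : RefinesDegree m)
    (W : Finset (Fin n)) :
    ∃ Φ : (MvPolynomial (Fin n) ℤ ⧸ Ideal.span (A.relations W)) ≃+* A.VG W,
      (∀ i, Φ (Ideal.Quotient.mk _ (MvPolynomial.X i)) = A.heaviside W i) ∧
      ∃ b : Module.Basis (A.nbc m W) ℤ (A.VG W),
        ∀ N, b N = Φ (Ideal.Quotient.mk _ (sqfreeMonomial N.1)) := by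
  obtain ⟨Φ, hΦ, b, hb⟩ := exists_quotient_ringEquiv_basis (ι := A.nbc m W)
    (Ideal.span (A.relations W))
    (MvPolynomial.aeval (R := ℤ) (A.heaviside W) : MvPolynomial (Fin n) ℤ →+* A.VG W)
    (fun x hx => A.aeval_heaviside_of_mem_span hx) (A.aeval_heaviside_surjective W)
    (fun N => sqfreeMonomial N.1) (A.exists_sub_sum_sqfreeMonomial_mem hm (Or.inr rfl)) (by
      simpa [aeval_heaviside_sqfreeMonomial] using A.linearIndependent_heavisideProd m W)
  exact ⟨Φ, fun i => (hΦ _).trans (by simp), b, hb⟩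

/-- The images of the NBC monomials are exactly the basis of symbols B, which gives surjectivity and
independence. Spanning comes from reduction modulo the initial forms. -/
theorem exists_grVG_presentation {m : MonomialOrder (Fin n)} (hm : RefinesDegree m)
    (W : Finset (Fin n)) :
    ∃ Ψ : (MvPolynomial (Fin n) ℤ ⧸ Ideal.span (inDeg '' A.relations W)) ≃+* A.GrVG W,
      (∀ i, Ψ (Ideal.Quotient.mk _ (MvPolynomial.X i)) = A.grHeaviside W i) ∧
      ∃ b : Module.Basis (A.nbc m W) ℤ (A.GrVG W),
        ∀ N, b N = Ψ (Ideal.Quotient.mk _ (sqfreeMonomial N.1)) := by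
  obtain ⟨B, hB⟩ := (A.degreeFiltration W).exists_basis_gr
    (A.linearIndependent_heavisideProd m W) (A.degreeFiltration_eq_span_nbc hm W)
  have hmon : ∀ N : A.nbc m W,
      MvPolynomial.aeval (A.grHeaviside W) (sqfreeMonomial N.1 : MvPolynomial (Fin n) ℤ) = B N := by
    intro N
    obtain ⟨h, hN⟩ := RingFiltration.isSymbol_aeval (A.isSymbol_grHeaviside W)
      (isHomogeneous_sqfreeMonomial N.1)
    rw [hN, hB]
    congr 1
    exact A.aeval_heaviside_sqfreeMonomial W N.1
  obtain ⟨Ψ, hΨ, b, hb⟩ := exists_quotient_ringEquiv_basis (ι := A.nbc m W)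
    (Ideal.span (inDeg '' A.relations W))
    (MvPolynomial.aeval (R := ℤ) (A.grHeaviside W) : MvPolynomial (Fin n) ℤ →+* A.GrVG W)
    (fun x hx => by
      have hle : Ideal.span (inDeg '' A.relations W) ≤
          RingHom.ker (MvPolynomial.aeval (R := ℤ) (A.grHeaviside W)) := by
        refine Ideal.span_le.2 ?_
        rintro _ ⟨g, hg, rfl⟩
        exact RingFiltration.aeval_inDeg_eq_zero (A.isSymbol_grHeaviside W)
          (A.aeval_heaviside_eq_zero hg)
      exact hle hx)
    (fun y => ⟨∑ N, B.repr y N • sqfreeMonomial N.1, by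
      conv_rhs => rw [← B.sum_repr y]
      rw [map_sum]
      refine Finset.sum_congr rfl fun N _ => ?_
      rw [map_zsmul]
      congr 1
      exact hmon N⟩)
    (fun N => sqfreeMonomial N.1) (A.exists_sub_sum_sqfreeMonomial_mem hm (Or.inl rfl)) (by
      have : (fun N : A.nbc m W => (MvPolynomial.aeval (R := ℤ) (A.grHeaviside W) :
          MvPolynomial (Fin n) ℤ →+* A.GrVG W) (sqfreeMonomial N.1)) = B := funext hmon
      rw [this]
      exact B.linearIndependent)
  exact ⟨Ψ, fun i => (hΨ _).trans (by simp), b, hb⟩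

end CentralArrangement

namespace CentralArrangement

variable {ℓ n : ℕ} (A : CentralArrangement ℓ n)

/-! ### The Poincaré polynomial -/

/-- The intersection of a set of hyperplanes. -/
noncomputable def flat (N : Finset (Fin n)) : Submodule ℝ (EuclideanSpace ℝ (Fin ℓ)) :=
  ⨅ i ∈ N, A.hyperplane i

theorem flat_mem_interiorIntersections {m : MonomialOrder (Fin n)} {W N : Finset (Fin n)}
    (hN : N ∈ A.nbc m W) : A.flat N ∈ A.interiorIntersections W := by
  classical
  exact (Finset.mem_filter.1 hN).2.2

theorem le_flat_iff {X : Submodule ℝ (EuclideanSpace ℝ (Fin ℓ))} {N : Finset (Fin n)} :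
    X ≤ A.flat N ↔ ∀ i ∈ N, X ≤ A.hyperplane i := by
  simp [flat]

/-- The flat is the orthogonal complement of the span of independent normals. -/
theorem finrank_quotient_flat {m : MonomialOrder (Fin n)} {W N : Finset (Fin n)}
    (hN : N ∈ A.nbc m W) :
    Module.finrank ℝ (EuclideanSpace ℝ (Fin ℓ) ⧸ A.flat N) = N.card := by
  have hli := A.linearIndepOn_of_nbc (A.mem_nbc.1 hN).1
  set U := Submodule.span ℝ (Set.range fun i : N => A.normal i.1) with hU
  have hflat : A.flat N = Uᗮ := by
    ext x
    rw [flat, mem_iInf_hyperplane, Submodule.mem_orthogonal]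
    constructor
    · intro h u hu
      rw [hU] at hu
      induction hu using Submodule.span_induction with
      | mem y hy => obtain ⟨i, rfl⟩ := hy; exact h i.1 i.2
      | zero => exact inner_zero_left _
      | add y z _ _ hy hz => rw [inner_add_left, hy, hz, add_zero]
      | smul c y _ hy => rw [inner_smul_left, hy, mul_zero]
    · exact fun h i hi => h _ (Submodule.subset_span ⟨⟨i, hi⟩, rfl⟩)
  have h1 : Module.finrank ℝ U = N.card := by
    have := finrank_span_eq_card (R := ℝ) (b := fun i : N => A.normal i.1) hli
    simpa using this
  have h2 := Submodule.finrank_add_finrank_orthogonal U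
  have h3 := Submodule.finrank_quotient_add_finrank (A.flat N)
  rw [hflat] at h3 ⊢
  omega

/-- The least element k of a circuit whose broken circuit lies in insert i N also satisfies X ≤ H_k.
If i were in the broken circuit, i ≤ k and k ≤ i would give i = k, the element removed. So the
broken circuit would already lie in N. -/
theorem insert_mem_nbc {m : MonomialOrder (Fin n)} {W N : Finset (Fin n)}
    {X : Submodule ℝ (EuclideanSpace ℝ (Fin ℓ))}
    (hX : ((X : Set (EuclideanSpace ℝ (Fin ℓ))) ∩ A.cone W).Nonempty) {i : Fin n}
    (hi : X ≤ A.hyperplane i) (hmin : ∀ j, X ≤ A.hyperplane j →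
      m.toSyn (Finsupp.single i 1) ≤ m.toSyn (Finsupp.single j 1))
    (hN : N ∈ A.nbc m W) (hXN : X ≤ A.flat N) : insert i N ∈ A.nbc m W := by
  obtain ⟨p, hpX, hpW⟩ := hX
  rw [le_flat_iff] at hXN
  have hall : ∀ j ∈ insert i N, X ≤ A.hyperplane j := by
    intro j hj
    rcases Finset.mem_insert.1 hj with rfl | hj
    exacts [hi, hXN j hj]
  refine A.mem_nbc.2 ⟨?_, p, hpW, fun j hj => A.mem_hyperplane.1 (hall j hj hpX)⟩
  rintro B ⟨C, hC, k, hk, hkmin, rfl⟩ hsub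
  have hXk : X ≤ A.hyperplane k := fun x hx => A.mem_hyperplane.2
    (hC.inner_eq_zero A hk fun j hj => A.mem_hyperplane.1 (hall j (hsub hj) hx))
  refine (A.mem_nbc.1 hN).1 _ ⟨C, hC, k, hk, hkmin, rfl⟩ fun j hj => ?_
  refine (Finset.mem_insert.1 (hsub hj)).resolve_left fun hji => ?_
  subst hji
  rw [Finset.mem_erase] at hj
  exact hj.1 (toSyn_single_injective m ((hmin k hXk).antisymm (hkmin j hj.2)))

theorem erase_mem_nbc {m : MonomialOrder (Fin n)} {W N : Finset (Fin n)}
    (hN : N ∈ A.nbc m W) (i : Fin n) : N.erase i ∈ A.nbc m W := by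
  obtain ⟨h, p, hp, hpN⟩ := A.mem_nbc.1 hN
  exact A.mem_nbc.2 ⟨fun B hB hsub => h B hB (hsub.trans (Finset.erase_subset _ _)), p, hp,
    fun j hj => hpN j (Finset.mem_of_mem_erase hj)⟩

open Classical in
/-- The alternating sum of the NBC sets below an interior flat vanishes, unless the flat is the
whole space. -/
theorem sum_neg_one_pow_nbc (m : MonomialOrder (Fin n)) {W : Finset (Fin n)}
    {X : Submodule ℝ (EuclideanSpace ℝ (Fin ℓ))} (hX : X ∈ A.interiorIntersections W) :
    ∑ N ∈ A.nbc m W with X ≤ A.flat N, (-1 : ℤ) ^ N.card = if X = ⊤ then 1 else 0 := by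
  split_ifs with htop
  · have hne : ∀ i, ¬ X ≤ A.hyperplane i := by
      intro i hi
      have : A.normal i ∈ A.hyperplane i := hi (htop ▸ Submodule.mem_top)
      rw [mem_hyperplane, inner_self_eq_zero] at this
      exact A.normal_ne_zero i this
    rw [Finset.sum_eq_single ∅]
    · simp
    · intro N hN hN0
      obtain ⟨i, hi⟩ := Finset.nonempty_iff_ne_empty.2 hN0
      exact absurd (A.le_flat_iff.1 (Finset.mem_filter.1 hN).2 i hi) (hne i)
    · intro h
      refine absurd (Finset.mem_filter.2 ⟨A.mem_nbc.2 ⟨?_, ?_⟩, ?_⟩) h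
      -- An empty broken circuit would be a one-element circuit, making a normal orthogonal to
      -- itself.
      · rintro B ⟨C, hC, i, hi, -, rfl⟩ hsub
        have h0 := hC.inner_eq_zero A hi (p := A.normal i) fun j hj => absurd (hsub hj) (by simp)
        exact A.normal_ne_zero i (inner_self_eq_zero.1 h0)
      · obtain ⟨p, -, hp⟩ := hX.2
        exact ⟨p, hp, by simp⟩
      · simp [le_flat_iff]
  · have hex : (Finset.univ.filter fun i => X ≤ A.hyperplane i).Nonempty := by
      by_contra hno
      rw [Finset.not_nonempty_iff_eq_empty, Finset.filter_eq_empty_iff] at hno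
      obtain ⟨S, rfl⟩ := hX.1
      refine htop ?_
      have hS : S = ∅ := Finset.eq_empty_of_forall_notMem fun i hi =>
        hno (Finset.mem_univ i) (iInf₂_le i hi)
      simp [hS]
    obtain ⟨i, hi, hmin⟩ := Finset.exists_min_image _
      (fun i => m.toSyn (Finsupp.single i 1)) hex
    simp only [Finset.mem_filter, Finset.mem_univ, true_and] at hi hmin
    -- Toggling the smallest i with X ≤ H_i is a sign-reversing involution without fixed points.
    refine Finset.sum_involution (fun N _ => if i ∈ N then N.erase i else insert i N)
      (fun N _ => ?_) (fun N _ _ => ?_) (fun N hN => ?_) (fun N _ => ?_)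
    · split_ifs with h
      · obtain ⟨k, hk⟩ := Nat.exists_eq_succ_of_ne_zero (Finset.card_ne_zero_of_mem h)
        rw [Finset.card_erase_of_mem h, hk, Nat.succ_sub_one, pow_succ]
        ring
      · rw [Finset.card_insert_of_notMem h, pow_succ]
        ring
    · split_ifs with h
      · exact fun he => Finset.notMem_erase i N (he.symm ▸ h)
      · exact fun he => h (he ▸ Finset.mem_insert_self i N)
    · rw [Finset.mem_filter] at hN
      rw [Finset.mem_filter]
      split_ifs with h
      · exact ⟨A.erase_mem_nbc hN.1 i, A.le_flat_iff.2 fun j hj =>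
          A.le_flat_iff.1 hN.2 j (Finset.mem_of_mem_erase hj)⟩
      · refine ⟨A.insert_mem_nbc hX.2 hi hmin hN.1 hN.2, A.le_flat_iff.2 fun j hj => ?_⟩
        rcases Finset.mem_insert.1 hj with rfl | hj
        exacts [hi, A.le_flat_iff.1 hN.2 j hj]
    · split_ifs with h h' h'
      · exact absurd h' (Finset.notMem_erase i N)
      · exact Finset.insert_erase h
      · exact Finset.erase_insert h
      · exact absurd (Finset.mem_insert_self i N) h'

open Classical in
/-- Rota's formula: the Möbius function counts NBC sets, with a sign. -/
theorem mu_eq_sum_nbc (m : MonomialOrder (Fin n)) (W : Finset (Fin n)) (X : A.IntPoset W) :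
    IncidenceAlgebra.mu ℤ (A.wholeSpace W X) X
      = ∑ N ∈ A.nbc m W with A.flat N = OrderDual.ofDual X.1, (-1 : ℤ) ^ N.card := by
  set V := A.wholeSpace W X with hV
  have hVle : ∀ Y : A.IntPoset W, V ≤ Y := fun Y => (le_top : OrderDual.ofDual Y.1 ≤ ⊤)
  -- Grouping the NBC sets N with Y ≤ flat N by their flats turns `sum_neg_one_pow_nbc` into the
  -- recursion that defines μ.
  have hsum : ∀ Y : A.IntPoset W, ∑ Z ∈ Finset.Icc V Y,
      ∑ N ∈ A.nbc m W with A.flat N = OrderDual.ofDual Z.1, (-1 : ℤ) ^ N.card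
        = if V = Y then 1 else 0 := by
    intro Y
    have hVY : V = Y ↔ OrderDual.ofDual Y.1 = ⊤ :=
      ⟨fun h => h ▸ rfl, fun h => Subtype.ext (congrArg OrderDual.toDual h).symm⟩
    rw [if_congr hVY rfl rfl, ← A.sum_neg_one_pow_nbc m Y.2, Finset.sum_filter]
    simp only [Finset.sum_filter]
    rw [Finset.sum_comm]
    refine Finset.sum_congr rfl fun N hN => ?_
    split_ifs with h
    · rw [Finset.sum_eq_single (⟨OrderDual.toDual (A.flat N),
        A.flat_mem_interiorIntersections hN⟩ : A.IntPoset W)]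
      · exact if_pos rfl
      · exact fun Z _ hZ => if_neg fun he => hZ (Subtype.ext (congrArg OrderDual.toDual he).symm)
      · exact fun hno => absurd (Finset.mem_Icc.2 ⟨hVle _, h⟩) hno
    · refine Finset.sum_eq_zero fun Z hZ => if_neg fun he => h ?_
      rw [he]
      exact (Finset.mem_Icc.1 hZ).2
  suffices h : ∀ Y : A.IntPoset W, IncidenceAlgebra.mu ℤ V Y
      = ∑ N ∈ A.nbc m W with A.flat N = OrderDual.ofDual Y.1, (-1 : ℤ) ^ N.card from h X
  intro Y
  induction Y using WellFoundedLT.induction with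
  | ind Y ih =>
    -- Both functions have the same sum over [V, Y] and agree below Y by induction, hence they agree
    -- at Y.
    have h1 := (IncidenceAlgebra.sum_Icc_mu_right (𝕜 := ℤ) V Y).trans (hsum Y).symm
    rw [← Finset.Ico_insert_right (hVle Y), Finset.sum_insert Finset.right_notMem_Ico,
      Finset.sum_insert Finset.right_notMem_Ico,
      Finset.sum_congr rfl fun Z hZ => ih Z (Finset.mem_Ico.1 hZ).2] at h1
    exact add_right_cancel h1

-- All NBC sets with a given flat have the same size, so their signs coincide and |μ| is their
-- number.
open Classical in
theorem poincare_eq (m : MonomialOrder (Fin n)) (W : Finset (Fin n)) :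
    A.poincare W = ∑ N ∈ A.nbc m W, (Polynomial.X : Polynomial ℤ) ^ N.card := by
  have hterm : ∀ X : A.IntPoset W,
      Polynomial.C |IncidenceAlgebra.mu ℤ (A.wholeSpace W X) X| *
        (Polynomial.X : Polynomial ℤ) ^ Module.finrank ℝ
          (EuclideanSpace ℝ (Fin ℓ) ⧸ (OrderDual.ofDual X.1))
      = ∑ N ∈ A.nbc m W with A.flat N = OrderDual.ofDual X.1, Polynomial.X ^ N.card := by
    intro X
    have hcard : ∀ N ∈ (A.nbc m W).filter fun N => A.flat N = OrderDual.ofDual X.1,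
        N.card = Module.finrank ℝ (EuclideanSpace ℝ (Fin ℓ) ⧸ (OrderDual.ofDual X.1)) := by
      intro N hN
      rw [Finset.mem_filter] at hN
      rw [← hN.2, A.finrank_quotient_flat hN.1]
    rw [A.mu_eq_sum_nbc m,
      Finset.sum_congr rfl fun N hN => congrArg (fun k => (-1 : ℤ) ^ k) (hcard N hN),
      Finset.sum_congr rfl fun N hN =>
        congrArg (fun k => (Polynomial.X : Polynomial ℤ) ^ k) (hcard N hN),
      Finset.sum_const, Finset.sum_const,
      abs_nsmul, abs_pow, abs_neg, abs_one, one_pow, nsmul_eq_mul, nsmul_eq_mul]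
    simp
  rw [poincare, Finset.sum_congr rfl fun X _ => hterm X]
  simp only [Finset.sum_filter]
  rw [Finset.sum_comm]
  refine Finset.sum_congr rfl fun N hN => ?_
  rw [Finset.sum_eq_single (⟨OrderDual.toDual (A.flat N),
    A.flat_mem_interiorIntersections hN⟩ : A.IntPoset W)]
  · exact if_pos rfl
  · exact fun Z _ hZ => if_neg fun he => hZ (Subtype.ext (congrArg OrderDual.toDual he).symm)
  · exact fun hno => absurd (Finset.mem_univ _) hno

end CentralArrangement

theorem theorem1 {ℓ n : ℕ} (A : CentralArrangement ℓ n) (W : Finset (Fin n))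
    (m : MonomialOrder (Fin n)) (hm : RefinesDegree m) :
    ∃ (Φ : (MvPolynomial (Fin n) ℤ ⧸ Ideal.span (A.relations W)) ≃+* A.VG W)
      (Ψ : (MvPolynomial (Fin n) ℤ ⧸ Ideal.span (inDeg '' A.relations W)) ≃+* A.GrVG W),
      (∀ i, Φ (Ideal.Quotient.mk _ (MvPolynomial.X i)) = A.heaviside W i) ∧
      (∀ i, Ψ (Ideal.Quotient.mk _ (MvPolynomial.X i)) = A.grHeaviside W i) ∧
      (∃ b : Module.Basis (A.nbc m W) ℤ (A.VG W),
        ∀ N, b N = Φ (Ideal.Quotient.mk _ (sqfreeMonomial N.1))) ∧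
      (∃ b : Module.Basis (A.nbc m W) ℤ (A.GrVG W),
        ∀ N, b N = Ψ (Ideal.Quotient.mk _ (sqfreeMonomial N.1))) ∧
      (A.degreeFiltration W).hilbertSeries
        = ∑ N ∈ A.nbc m W, (PowerSeries.X : PowerSeries ℤ) ^ N.card ∧
      (A.degreeFiltration W).hilbertSeries = (A.poincare W : PowerSeries ℤ) := by
  obtain ⟨Φ, hΦ, hb⟩ := A.exists_vg_presentation hm W
  obtain ⟨Ψ, hΨ, hb'⟩ := A.exists_grVG_presentation hm W
  refine ⟨Φ, Ψ, hΦ, hΨ, hb, hb', A.hilbertSeries_eq hm W, ?_⟩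
  rw [A.hilbertSeries_eq hm W, A.poincare_eq m W, ← Polynomial.coeToPowerSeries.ringHom_apply,
    map_sum]
  simp
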